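/- Let $n\ge 2$ and $0<r<R$. For open balls $B_1,B_2\subset\mathbb{R}^n$ of radii $R$ and $r$ with $\overline{B_2}\subset B_1$, consider on $\Omega=B_1\setminus\overline{B_2}$ the eigenvalue problem $$\begin{cases}\Delta u=0 & \text{in } \Omega,\\ u=0 & \text{on } \partial B_2,\\ \dfrac{\partial u}{\partial n}=\tau u & \text{on } \partial B_1,\end{cases}$$ where $\partial/\partial n$ is the outer normal derivative. It is understood weakly: $\tau\in\mathbb{R}$ is an eigenvalue if there is a nonzero $u\in H^1(\Omega)$ with zero trace on $\partial B_2$ such that $\int_\Omega\nabla u\cdot\nabla v\,dx=\tau\int_{\partial B_1}uv\,d\sigma$ for all $v\in H^1(\Omega)$ with zero trace on $\partial B_2$. Then there is a smallest nonzero eigenvalue $\tau_1(B_1\setminus\overline{B_2})$, and it is positive. Moreover, among all such pairs of balls with the fixed radii $R$ and $r$, $\tau_1(B_1\setminus\overline{B_2})$ attains its maximal value when $B_1$ and $B_2$ are concentric, and only then. -/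

import Mathlib

open MeasureTheory Filter Topology Metric Set
open scoped ContDiff Gradient

noncomputable section

namespace DirichletSteklov

variable {n : ℕ}

/-- The domain `B₁ \ closure B₂`, where `B₁ = B(c₁, R)` and `B₂ = B(c₂, r)`. -/
def perforatedBall (c₁ : EuclideanSpace ℝ (Fin n)) (R : ℝ)
    (c₂ : EuclideanSpace ℝ (Fin n)) (r : ℝ) : Set (EuclideanSpace ℝ (Fin n)) :=
  ball c₁ R \ closedBall c₂ r

/-- The surface measure of the sphere of centre `c` and radius `ρ` in `ℝⁿ`, as a measure on `ℝⁿ`: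
the image of the surface measure of the unit sphere under `y ↦ c + ρ y`, times `ρ ^ (n - 1)`. -/
def surfaceMeasure (c : EuclideanSpace ℝ (Fin n)) (ρ : ℝ) :
    Measure (EuclideanSpace ℝ (Fin n)) :=
  ENNReal.ofReal (ρ ^ (n - 1)) •
    Measure.map (fun y : sphere (0 : EuclideanSpace ℝ (Fin n)) 1 =>
        c + ρ • (y : EuclideanSpace ℝ (Fin n)))
      (volume : Measure (EuclideanSpace ℝ (Fin n))).toSphere

/-- `u ∈ H¹(Ω)` with weak gradient `G`: both are square integrable on `Ω`, and
`∫_Ω u ∂_v φ = - ∫_Ω ⟨G, v⟩ φ` for all test functions `φ ∈ C_c^∞(Ω)` and all directions `v`. -/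
structure IsH1 (Ω : Set (EuclideanSpace ℝ (Fin n))) (u : EuclideanSpace ℝ (Fin n) → ℝ)
    (G : EuclideanSpace ℝ (Fin n) → EuclideanSpace ℝ (Fin n)) : Prop where
  memLp : MemLp u 2 (volume.restrict Ω)
  memLp_grad : MemLp G 2 (volume.restrict Ω)
  weak_grad : ∀ φ : EuclideanSpace ℝ (Fin n) → ℝ, ContDiff ℝ ∞ φ → HasCompactSupport φ →
    tsupport φ ⊆ Ω → ∀ v : EuclideanSpace ℝ (Fin n),
      ∫ x in Ω, u x * fderiv ℝ φ x v = - ∫ x in Ω, inner ℝ (G x) v * φ x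

/-- `t ∈ L²(σ)` is the trace of `u ∈ H¹(Ω)` (with weak gradient `G`) on the part of the boundary
that carries the surface measure `σ`: there are functions `φ k`, smooth up to the boundary, with
`φ k → u` in `H¹(Ω)` and `φ k → t` in `L²(σ)`. (On a Lipschitz domain the restriction map is
continuous from `H¹(Ω)` to `L²(σ)` and smooth functions are dense, so this is the graph of the
trace operator.) -/
def IsTrace (Ω : Set (EuclideanSpace ℝ (Fin n))) (σ : Measure (EuclideanSpace ℝ (Fin n)))
    (u : EuclideanSpace ℝ (Fin n) → ℝ)
    (G : EuclideanSpace ℝ (Fin n) → EuclideanSpace ℝ (Fin n))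
    (t : EuclideanSpace ℝ (Fin n) → ℝ) : Prop :=
  MemLp t 2 σ ∧
    ∃ φ : ℕ → EuclideanSpace ℝ (Fin n) → ℝ, (∀ k, ContDiff ℝ ∞ (φ k)) ∧
      Tendsto (fun k => eLpNorm (fun x => φ k x - u x) 2 (volume.restrict Ω)) atTop (𝓝 0) ∧
      Tendsto (fun k => eLpNorm (fun x => ∇ (φ k) x - G x) 2 (volume.restrict Ω)) atTop (𝓝 0) ∧
      Tendsto (fun k => eLpNorm (fun x => φ k x - t x) 2 σ) atTop (𝓝 0)

/-- `u ∈ H¹(B₁ \ closure B₂)` with weak gradient `G`, trace `t` on `∂B₁` and trace `0` on `∂B₂`. -/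
structure IsAdmissible (c₁ : EuclideanSpace ℝ (Fin n)) (R : ℝ)
    (c₂ : EuclideanSpace ℝ (Fin n)) (r : ℝ) (u : EuclideanSpace ℝ (Fin n) → ℝ)
    (G : EuclideanSpace ℝ (Fin n) → EuclideanSpace ℝ (Fin n))
    (t : EuclideanSpace ℝ (Fin n) → ℝ) : Prop where
  isH1 : IsH1 (perforatedBall c₁ R c₂ r) u G
  trace_outer : IsTrace (perforatedBall c₁ R c₂ r) (surfaceMeasure c₁ R) u G t
  trace_inner : IsTrace (perforatedBall c₁ R c₂ r) (surfaceMeasure c₂ r) u G 0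

/-- `τ` is an eigenvalue of the problem `Δu = 0` in `Ω = B₁ \ closure B₂`, `u = 0` on `∂B₂`,
`∂u/∂n = τ u` on `∂B₁`: there is a nonzero weak solution, that is, a nonzero `u ∈ H¹(Ω)` that
vanishes on `∂B₂` and satisfies `∫_Ω ∇u · ∇v = τ ∫_{∂B₁} u v` for all `v ∈ H¹(Ω)` that vanish
on `∂B₂`. -/
def IsEigenvalue (c₁ : EuclideanSpace ℝ (Fin n)) (R : ℝ)
    (c₂ : EuclideanSpace ℝ (Fin n)) (r : ℝ) (τ : ℝ) : Prop :=
  ∃ u G t, IsAdmissible c₁ R c₂ r u G t ∧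
    ¬ (u =ᵐ[volume.restrict (perforatedBall c₁ R c₂ r)] 0) ∧
    ∀ v H s, IsAdmissible c₁ R c₂ r v H s →
      ∫ x in perforatedBall c₁ R c₂ r, inner ℝ (G x) (H x)
        = τ * ∫ x, t x * s x ∂(surfaceMeasure c₁ R)

/-- The set of nonzero eigenvalues. -/
def nonzeroEigenvalues (c₁ : EuclideanSpace ℝ (Fin n)) (R : ℝ)
    (c₂ : EuclideanSpace ℝ (Fin n)) (r : ℝ) : Set ℝ :=
  {τ | τ ≠ 0 ∧ IsEigenvalue c₁ R c₂ r τ}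

/-- The first nonzero eigenvalue `τ₁(B₁ \ closure B₂)`. -/
def firstEigenvalue (c₁ : EuclideanSpace ℝ (Fin n)) (R : ℝ)
    (c₂ : EuclideanSpace ℝ (Fin n)) (r : ℝ) : ℝ :=
  sInf (nonzeroEigenvalues c₁ R c₂ r)

end DirichletSteklov

end

/-!
The quotient `(∫_{∂B₁} u²) / ∫_Ω |∇u|²` attains a maximum `m` over the admissible functions because
the trace is compact with respect to the gradient norm, and `τ₁ = m⁻¹`.

Let `Φ(ρ) = ∫_r^ρ s^(1-n) ds` and let `|S|` be the area of the unit sphere. For every position of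
`B₁` the radial harmonic function `x ↦ Φ(|x - c₂|)` serves as a test function.

* Its Dirichlet integral is `∫_Ω |x - c₂|^(2-2n) dx`. The integrand decreases in `|x - c₂|`, so
  among the balls `B₁` of radius `R` the integral is largest, with value `Φ(R) |S|`, exactly for the
  one centred at `c₂`.
* Its mean over `∂B₁` is `Φ(R)`: by Green's identity the difference between its mean over the sphere
  `∂B(c₁, ρ)` and `Φ(ρ)` does not depend on `ρ ≥ R`, and it tends to `0` as `ρ → ∞`. By Jensen's
  inequality its square then integrates over `∂B₁` to at least `R^(n-1) Φ(R)² |S|`.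

Hence `τ₁ ≤ (R^(n-1) Φ(R))⁻¹`, strictly unless the balls are concentric. For concentric balls,
Cauchy–Schwarz along the rays bounds `∫_{∂B₁} u²` by `R^(n-1) Φ(R) ∫_Ω |∇u|²`, so equality holds.
-/

noncomputable section

open scoped ENNReal NNReal

namespace DirichletSteklov

section Polar

variable {E : Type*} [NormedAddCommGroup E] [NormedSpace ℝ E]

theorem add_smul_mem_ball_iff (c : E) {s : ℝ} (hs : 0 ≤ s) (w : sphere (0 : E) 1) {b : ℝ} :
    c + s • (w : E) ∈ ball c b ↔ s < b := by
  simp [norm_smul, abs_of_nonneg hs]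

theorem add_smul_mem_closedBall_iff (c : E) {s : ℝ} (hs : 0 ≤ s) (w : sphere (0 : E) 1) {b : ℝ} :
    c + s • (w : E) ∈ closedBall c b ↔ s ≤ b := by
  simp [norm_smul, abs_of_nonneg hs]

theorem add_smul_mem_annulus_iff (c : E) {s : ℝ} (hs : 0 < s) (w : sphere (0 : E) 1) {a b : ℝ} :
    c + s • (w : E) ∈ ball c b \ closedBall c a ↔ s ∈ Ioo a b := by
  rw [Set.mem_sdiff, add_smul_mem_ball_iff c hs.le, add_smul_mem_closedBall_iff c hs.le, not_le,
    and_comm, mem_Ioo]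

variable [MeasurableSpace E] [BorelSpace E] [FiniteDimensional ℝ E]

theorem lintegral_volumeIoiPow (m : ℕ) {f : ℝ → ℝ≥0∞} (hf : Measurable f) :
    ∫⁻ s, f s ∂(Measure.volumeIoiPow m) = ∫⁻ s in Ioi (0 : ℝ), ENNReal.ofReal (s ^ m) * f s := by
  rw [Measure.volumeIoiPow, lintegral_withDensity_eq_lintegral_mul _ (by fun_prop) (by fun_prop),
    ← lintegral_subtype_comap measurableSet_Ioi]
  rfl

theorem integral_volumeIoiPow (m : ℕ) (f : ℝ → ℝ) :
    ∫ s, f s ∂(Measure.volumeIoiPow m) = ∫ s in Ioi (0 : ℝ), s ^ m * f s := by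
  rw [Measure.volumeIoiPow, integral_withDensity_eq_integral_toReal_smul (by fun_prop) (by simp),
    ← integral_subtype_comap measurableSet_Ioi]
  refine integral_congr_ae (ae_of_all _ fun s => ?_)
  simp only [smul_eq_mul, ENNReal.toReal_ofReal (pow_nonneg s.2.le m)]

variable [Nontrivial E] (μ : Measure E) [μ.IsAddHaarMeasure]

theorem measurePreserving_polar (c : E) :
    MeasurePreserving (fun p : sphere (0 : E) 1 × Ioi (0 : ℝ) => c + (p.2 : ℝ) • (p.1 : E))
      (μ.toSphere.prod (Measure.volumeIoiPow (Module.finrank ℝ E - 1))) μ := by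
  have hval : MeasurePreserving ((↑) : ({0}ᶜ : Set E) → E) (μ.comap (↑)) μ := by
    simpa only [restrict_compl_singleton] using
      measurePreserving_subtype_coe (μa := μ) (measurableSet_singleton (0 : E)).compl
  exact (measurePreserving_add_left μ c).comp <| hval.comp <|
    μ.measurePreserving_homeomorphUnitSphereProd.symm
      (homeomorphUnitSphereProd E).toMeasurableEquiv

theorem lintegral_polar (c : E) {f : E → ℝ≥0∞} (hf : Measurable f) :
    ∫⁻ x, f x ∂μ = ∫⁻ w, (∫⁻ s in Ioi (0 : ℝ),
      ENNReal.ofReal (s ^ (Module.finrank ℝ E - 1)) * f (c + s • (w : E))) ∂μ.toSphere := by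
  rw [← (measurePreserving_polar μ c).lintegral_comp hf, lintegral_prod _ (by fun_prop)]
  exact lintegral_congr fun w => lintegral_volumeIoiPow _ (f := fun s => f (c + s • (w : E)))
    (by fun_prop)

theorem integral_polar (c : E) {f : E → ℝ} (hf : Integrable f μ) :
    ∫ x, f x ∂μ = ∫ w, (∫ s in Ioi (0 : ℝ),
      s ^ (Module.finrank ℝ E - 1) * f (c + s • (w : E))) ∂μ.toSphere := by
  have hp := measurePreserving_polar μ c
  have hmap := integral_map hp.aemeasurable (hp.map_eq.symm ▸ hf.1)
  rw [hp.map_eq] at hmap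
  refine (hmap.trans (integral_prod _ (hp.integrable_comp_of_integrable hf))).trans ?_
  exact integral_congr_ae (ae_of_all _ fun w =>
    integral_volumeIoiPow _ fun s => f (c + s • (w : E)))

theorem setLIntegral_polar (c : E) {A : Set E} (hA : MeasurableSet A) {f : E → ℝ≥0∞}
    (hf : Measurable f) {α β : sphere (0 : E) 1 → ℝ} (hα : ∀ w, 0 ≤ α w)
    (h : ∀ (w : sphere (0 : E) 1) (s : ℝ), 0 < s → (c + s • (w : E) ∈ A ↔ s ∈ Ioo (α w) (β w))) :
    ∫⁻ x in A, f x ∂μ = ∫⁻ w, (∫⁻ s in Ioo (α w) (β w),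
      ENNReal.ofReal (s ^ (Module.finrank ℝ E - 1)) * f (c + s • (w : E))) ∂μ.toSphere := by
  rw [← lintegral_indicator hA, lintegral_polar μ c (hf.indicator hA)]
  refine lintegral_congr fun w => ?_
  have hsub : Ioo (α w) (β w) ⊆ Ioi 0 := fun s hs => (hα w).trans_lt hs.1
  rw [← inter_eq_self_of_subset_left hsub, ← setLIntegral_indicator measurableSet_Ioo]
  refine setLIntegral_congr_fun measurableSet_Ioi fun s hs => ?_
  by_cases hs' : s ∈ Ioo (α w) (β w)
  · simp only [indicator_of_mem hs', indicator_of_mem ((h w s hs).2 hs')]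
  · simp only [indicator_of_notMem hs', indicator_of_notMem (mt (h w s hs).1 hs'), mul_zero]

theorem setIntegral_polar (c : E) {A : Set E} (hA : MeasurableSet A) {f : E → ℝ}
    (hf : IntegrableOn f A μ) {α β : sphere (0 : E) 1 → ℝ} (hα : ∀ w, 0 ≤ α w)
    (h : ∀ (w : sphere (0 : E) 1) (s : ℝ), 0 < s → (c + s • (w : E) ∈ A ↔ s ∈ Ioo (α w) (β w))) :
    ∫ x in A, f x ∂μ = ∫ w, (∫ s in Ioo (α w) (β w),
      s ^ (Module.finrank ℝ E - 1) * f (c + s • (w : E))) ∂μ.toSphere := by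
  rw [← integral_indicator hA, integral_polar μ c (hf.integrable_indicator hA)]
  refine integral_congr_ae (ae_of_all _ fun w => ?_)
  have hsub : Ioo (α w) (β w) ⊆ Ioi 0 := fun s hs => (hα w).trans_lt hs.1
  simp only
  rw [← inter_eq_self_of_subset_right hsub, ← setIntegral_indicator measurableSet_Ioo]
  refine setIntegral_congr_fun measurableSet_Ioi fun s hs => ?_
  by_cases hs' : s ∈ Ioo (α w) (β w)
  · simp only [indicator_of_mem hs', indicator_of_mem ((h w s hs).2 hs')]
  · simp only [indicator_of_notMem hs', indicator_of_notMem (mt (h w s hs).1 hs'), mul_zero]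

theorem setLIntegral_annulus (c : E) {a : ℝ} (ha : 0 ≤ a) (b : ℝ) {f : E → ℝ≥0∞}
    (hf : Measurable f) :
    ∫⁻ x in ball c b \ closedBall c a, f x ∂μ = ∫⁻ w, (∫⁻ s in Ioo a b,
      ENNReal.ofReal (s ^ (Module.finrank ℝ E - 1)) * f (c + s • (w : E))) ∂μ.toSphere :=
  setLIntegral_polar μ c (measurableSet_ball.diff measurableSet_closedBall) hf (fun _ => ha)
    fun w _s hs => add_smul_mem_annulus_iff c hs w

end Polar

section RadialResistance

/-- The integral `∫ s⁻ᵐ` over `[a, b]`. For `m = n - 1` it is, up to the area of the unit sphere,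
the electrical resistance between the spheres of radii `a` and `b` in `ℝⁿ`. -/
def radialResistance (m : ℕ) (a b : ℝ) : ℝ := ∫ s in a..b, (s ^ m)⁻¹

theorem intervalIntegrable_inv_pow (m : ℕ) {a b : ℝ} (ha : 0 < a) (hb : 0 < b) :
    IntervalIntegrable (fun s : ℝ => (s ^ m)⁻¹) volume a b :=
  ContinuousOn.intervalIntegrable <| ContinuousOn.inv₀ (by fun_prop) fun _ hs =>
    (pow_pos ((lt_min ha hb).trans_le hs.1) _).ne'

theorem radialResistance_pos (m : ℕ) {a b : ℝ} (ha : 0 < a) (hab : a < b) :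
    0 < radialResistance m a b :=
  intervalIntegral.intervalIntegral_pos_of_pos_on
    (intervalIntegrable_inv_pow m ha (ha.trans hab))
    (fun _ hs => inv_pos.2 (pow_pos (ha.trans hs.1) _)) hab

theorem radialResistance_mono (m : ℕ) {a s t b : ℝ} (ha : 0 < a) (has : a ≤ s) (hst : s ≤ t)
    (htb : t ≤ b) : radialResistance m s t ≤ radialResistance m a b := by
  refine intervalIntegral.integral_mono_interval has hst htb ?_
    (intervalIntegrable_inv_pow m ha (by linarith))
  filter_upwards [ae_restrict_mem measurableSet_Ioc] with x hx
  exact inv_nonneg.2 (pow_nonneg (ha.le.trans hx.1.le) _)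

theorem ofReal_radialResistance (m : ℕ) {a b : ℝ} (ha : 0 < a) (hab : a ≤ b) :
    ENNReal.ofReal (radialResistance m a b) = ∫⁻ s in Ioo a b, (ENNReal.ofReal (s ^ m))⁻¹ := by
  rw [radialResistance, intervalIntegral.integral_of_le hab, integral_Ioc_eq_integral_Ioo,
    ofReal_integral_eq_lintegral_ofReal]
  · refine setLIntegral_congr_fun measurableSet_Ioo fun s hs => ?_
    rw [ENNReal.ofReal_inv_of_pos (pow_pos (ha.trans hs.1) _)]
  · exact (intervalIntegrable_inv_pow m ha (ha.trans_le hab)).1.mono_set Ioo_subset_Ioc_self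
  · filter_upwards [ae_restrict_mem measurableSet_Ioo] with s hs
    exact inv_nonneg.2 (pow_nonneg (ha.le.trans hs.1.le) _)

end RadialResistance

section OneDimensional

theorem sq_lintegral_le_lintegral_inv_mul {α : Type*} [MeasurableSpace α] {μ : Measure α}
    {g v : α → ℝ≥0∞} (hg : AEMeasurable g μ) (hv : AEMeasurable v μ) (hv0 : ∀ᵐ x ∂μ, v x ≠ 0)
    (hv_top : ∀ᵐ x ∂μ, v x ≠ ⊤) :
    (∫⁻ x, g x ∂μ) ^ 2 ≤ (∫⁻ x, (v x)⁻¹ ∂μ) * ∫⁻ x, v x * g x ^ 2 ∂μ := by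
  have hsplit : ∫⁻ x, g x ∂μ =
      ∫⁻ x, ((fun x => v x ^ (-(1 / 2) : ℝ)) * ((fun x => v x ^ (1 / 2 : ℝ)) * g)) x ∂μ := by
    refine lintegral_congr_ae ?_
    filter_upwards [hv0, hv_top] with x h0 ht
    simp only [Pi.mul_apply]
    rw [← mul_assoc, ← ENNReal.rpow_add _ _ h0 ht, neg_add_cancel, ENNReal.rpow_zero, one_mul]
  have hholder := ENNReal.lintegral_mul_le_Lp_mul_Lq μ Real.HolderConjugate.two_two
    (hv.pow_const (-(1 / 2) : ℝ)) ((hv.pow_const (1 / 2 : ℝ)).mul hg)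
  rw [← hsplit] at hholder
  have hinv : ∀ x, (v x ^ (-(1 / 2) : ℝ)) ^ (2 : ℝ) = (v x)⁻¹ := fun x => by
    rw [← ENNReal.rpow_mul, ← ENNReal.rpow_neg_one]; norm_num
  have hmul : ∀ x, (v x ^ (1 / 2 : ℝ) * g x) ^ (2 : ℝ) = v x * g x ^ 2 := fun x => by
    rw [ENNReal.mul_rpow_of_nonneg _ _ zero_le_two, ← ENNReal.rpow_mul, ENNReal.rpow_two]; norm_num
  simp only [Pi.mul_apply, hinv, hmul] at hholder
  calc (∫⁻ x, g x ∂μ) ^ 2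
      ≤ ((∫⁻ x, (v x)⁻¹ ∂μ) ^ (1 / 2 : ℝ) * (∫⁻ x, v x * g x ^ 2 ∂μ) ^ (1 / 2 : ℝ)) ^ 2 := by
        gcongr
    _ = (∫⁻ x, (v x)⁻¹ ∂μ) * ∫⁻ x, v x * g x ^ 2 ∂μ := by
        rw [mul_pow, ← ENNReal.rpow_natCast, ← ENNReal.rpow_natCast, ← ENNReal.rpow_mul,
          ← ENNReal.rpow_mul]
        norm_num

variable {E F : Type*} [NormedAddCommGroup E] [NormedSpace ℝ E] [NormedAddCommGroup F]

theorem enorm_sq_le_two_mul (x y : F) : ‖x‖ₑ ^ 2 ≤ 2 * ‖x - y‖ₑ ^ 2 + 2 * ‖y‖ₑ ^ 2 := by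
  have h : ‖x‖ₑ ≤ ‖x - y‖ₑ + ‖y‖ₑ := by simpa using enorm_add_le (x - y) y
  calc ‖x‖ₑ ^ 2 ≤ (‖x - y‖ₑ + ‖y‖ₑ) ^ 2 := by gcongr
    _ ≤ 2 * (‖x - y‖ₑ ^ 2 + ‖y‖ₑ ^ 2) := by
        have := ENNReal.rpow_add_le_mul_rpow_add_rpow ‖x - y‖ₑ ‖y‖ₑ one_le_two
        norm_num at this
        exact this
    _ = _ := mul_add _ _ _

variable [NormedSpace ℝ F]

theorem enorm_sub_le_lintegral_ray {φ : E → F} (hφ : ContDiff ℝ 1 φ) (c w : E) {a b : ℝ}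
    (hab : a ≤ b) :
    ‖φ (c + b • w) - φ (c + a • w)‖ₑ ≤
      ∫⁻ s in Ioo a b, ‖fderiv ℝ φ (c + s • w)‖ₑ * ‖w‖ₑ := by
  have hray : ContDiff ℝ 1 fun s : ℝ => φ (c + s • w) := hφ.comp (by fun_prop)
  refine (enorm_sub_le_lintegral_deriv_of_contDiffOn_Icc hray.contDiffOn hab).trans ?_
  rw [setLIntegral_congr Ioo_ae_eq_Icc]
  refine lintegral_mono fun s => ?_
  have hline : HasDerivAt (fun s : ℝ => c + s • w) w s := by
    simpa using ((hasDerivAt_id s).smul_const w).const_add c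
  have hderiv : deriv (fun s : ℝ => φ (c + s • w)) s = fderiv ℝ φ (c + s • w) w :=
    ((hφ.differentiable one_ne_zero _).hasFDerivAt.comp_hasDerivAt s hline).deriv
  rw [hderiv]
  exact (fderiv ℝ φ (c + s • w)).le_opENorm w

theorem enorm_sub_sq_le_lintegral_ray {φ : E → F} (hφ : ContDiff ℝ 1 φ) (m : ℕ) (c : E)
    (w : sphere (0 : E) 1) {a b : ℝ} (ha : 0 < a) (hab : a ≤ b) :
    ‖φ (c + b • (w : E)) - φ (c + a • (w : E))‖ₑ ^ 2 ≤ ENNReal.ofReal (radialResistance m a b) *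
      ∫⁻ s in Ioo a b, ENNReal.ofReal (s ^ m) * ‖fderiv ℝ φ (c + s • (w : E))‖ₑ ^ 2 := by
  have hmeas : Measurable fun s : ℝ => ‖fderiv ℝ φ (c + s • (w : E))‖ₑ :=
    ((hφ.continuous_fderiv one_ne_zero).comp (by fun_prop)).enorm.measurable
  have hpos : ∀ᵐ s ∂volume.restrict (Ioo a b), ENNReal.ofReal (s ^ m) ≠ 0 := by
    filter_upwards [ae_restrict_mem measurableSet_Ioo] with s hs
    simpa using pow_pos (ha.trans hs.1) m
  calc ‖φ (c + b • (w : E)) - φ (c + a • (w : E))‖ₑ ^ 2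
      ≤ (∫⁻ s in Ioo a b, ‖fderiv ℝ φ (c + s • (w : E))‖ₑ) ^ 2 := by
        gcongr
        simpa [enorm_eq_iff_norm_eq.2 (show ‖(w : E)‖ = ‖(1 : ℝ)‖ by simp)] using
          enorm_sub_le_lintegral_ray hφ c (w : E) hab
    _ ≤ _ := by
        rw [ofReal_radialResistance m ha hab]
        exact sq_lintegral_le_lintegral_inv_mul hmeas.aemeasurable (by fun_prop) hpos
          (ae_of_all _ fun _ => ENNReal.ofReal_ne_top)

theorem enorm_add_sub_sq_le_lintegral {φ : E → F} (hφ : ContDiff ℝ 1 φ) (x h : E) :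
    ‖φ (x + h) - φ x‖ₑ ^ 2 ≤ ‖h‖ₑ ^ 2 * ∫⁻ s in Ioo (0 : ℝ) 1, ‖fderiv ℝ φ (x + s • h)‖ₑ ^ 2 := by
  have hmeas : Measurable fun s : ℝ => ‖fderiv ℝ φ (x + s • h)‖ₑ :=
    ((hφ.continuous_fderiv one_ne_zero).comp (by fun_prop)).enorm.measurable
  have hcs : (∫⁻ s in Ioo (0 : ℝ) 1, ‖fderiv ℝ φ (x + s • h)‖ₑ) ^ 2 ≤
      ∫⁻ s in Ioo (0 : ℝ) 1, ‖fderiv ℝ φ (x + s • h)‖ₑ ^ 2 := by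
    simpa using sq_lintegral_le_lintegral_inv_mul (μ := volume.restrict (Ioo (0 : ℝ) 1))
      (v := fun _ => 1) hmeas.aemeasurable aemeasurable_const (by simp) (by simp)
  calc ‖φ (x + h) - φ x‖ₑ ^ 2
      ≤ ((∫⁻ s in Ioo (0 : ℝ) 1, ‖fderiv ℝ φ (x + s • h)‖ₑ) * ‖h‖ₑ) ^ 2 := by
        gcongr
        rw [← lintegral_mul_const' _ _ enorm_ne_top]
        simpa using enorm_sub_le_lintegral_ray hφ x h zero_le_one
    _ ≤ _ := by
        rw [mul_pow, mul_comm]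
        gcongr

theorem setLIntegral_ray_enorm_sq_le {φ : E → F} (hφ : ContDiff ℝ 1 φ) (m : ℕ) (c : E)
    (w : sphere (0 : E) 1) {r ρ L : ℝ} (hr : 0 < r) (hρL : ρ ≤ L) :
    ∫⁻ s in Ioo r ρ, ENNReal.ofReal (s ^ m) * ‖φ (c + s • (w : E))‖ₑ ^ 2 ≤
      ENNReal.ofReal (L ^ m * L) * (2 * ‖φ (c + r • (w : E))‖ₑ ^ 2 +
        2 * ENNReal.ofReal (radialResistance m r L) *
          ∫⁻ s in Ioo r ρ, ENNReal.ofReal (s ^ m) * ‖fderiv ℝ φ (c + s • (w : E))‖ₑ ^ 2) := by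
  rcases le_or_gt ρ r with h | hrρ
  · simp [Ioo_eq_empty_of_le h]
  have hL : 0 < L := by linarith
  set D := ∫⁻ s in Ioo r ρ, ENNReal.ofReal (s ^ m) * ‖fderiv ℝ φ (c + s • (w : E))‖ₑ ^ 2
  have hpt : ∀ s ∈ Ioo r ρ, ‖φ (c + s • (w : E))‖ₑ ^ 2 ≤ 2 * ‖φ (c + r • (w : E))‖ₑ ^ 2 +
      2 * ENNReal.ofReal (radialResistance m r L) * D := fun s hs =>
    calc ‖φ (c + s • (w : E))‖ₑ ^ 2 ≤ _ := enorm_sq_le_two_mul _ (φ (c + r • (w : E)))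
      _ ≤ 2 * (ENNReal.ofReal (radialResistance m r L) * D) + 2 * ‖φ (c + r • (w : E))‖ₑ ^ 2 := by
          grw [enorm_sub_sq_le_lintegral_ray hφ m c w hr hs.1.le,
            radialResistance_mono m hr le_rfl hs.1.le (hs.2.le.trans hρL)]
          gcongr
          exact lintegral_mono_set (Ioo_subset_Ioo_right hs.2.le)
      _ = _ := by ring
  calc _ ≤ ∫⁻ _ in Ioo r ρ, ENNReal.ofReal (L ^ m) * (2 * ‖φ (c + r • (w : E))‖ₑ ^ 2 +
      2 * ENNReal.ofReal (radialResistance m r L) * D) := by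
        refine setLIntegral_mono' measurableSet_Ioo fun s hs => ?_
        gcongr
        · exact (hr.trans hs.1).le
        · exact hs.2.le.trans hρL
        · exact hpt s hs
    _ ≤ _ := by
        rw [setLIntegral_const, Real.volume_Ioo, mul_right_comm,
          ← ENNReal.ofReal_mul (pow_nonneg hL.le m)]
        gcongr
        linarith

theorem enorm_sq_ray_le {φ : E → F} (hφ : ContDiff ℝ 1 φ) (m : ℕ) (c : E) (w : sphere (0 : E) 1)
    {a b R : ℝ} (ha : 0 < a) (hab : a < b) (hbR : b ≤ R) :
    ‖φ (c + R • (w : E))‖ₑ ^ 2 ≤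
      2 * ENNReal.ofReal (radialResistance m a R) *
          (∫⁻ s in Ioo a R, ENNReal.ofReal (s ^ m) * ‖fderiv ℝ φ (c + s • (w : E))‖ₑ ^ 2) +
        2 * (ENNReal.ofReal (a ^ m * (b - a)))⁻¹ *
          ∫⁻ s in Ioo a b, ENNReal.ofReal (s ^ m) * ‖φ (c + s • (w : E))‖ₑ ^ 2 := by
  set D := ∫⁻ s in Ioo a R, ENNReal.ofReal (s ^ m) * ‖fderiv ℝ φ (c + s • (w : E))‖ₑ ^ 2
  set P := ∫⁻ s in Ioo a b, ENNReal.ofReal (s ^ m) * ‖φ (c + s • (w : E))‖ₑ ^ 2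
  set K := ENNReal.ofReal (radialResistance m a R)
  set V := ENNReal.ofReal (a ^ m * (b - a)) with hV
  have hV0 : V ≠ 0 := by simpa [hV] using mul_pos (pow_pos ha m) (sub_pos.2 hab)
  have hpt : ∀ s ∈ Ioo a b, ENNReal.ofReal (a ^ m) * ‖φ (c + R • (w : E))‖ₑ ^ 2 ≤
      ENNReal.ofReal (a ^ m) * (2 * (K * D)) +
        2 * (ENNReal.ofReal (s ^ m) * ‖φ (c + s • (w : E))‖ₑ ^ 2) := fun s hs => by
    have hsR := hs.2.le.trans hbR
    grw [enorm_sq_le_two_mul (φ (c + R • (w : E))) (φ (c + s • (w : E))), mul_add,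
      enorm_sub_sq_le_lintegral_ray hφ m c w (ha.trans hs.1) hsR,
      radialResistance_mono m ha hs.1.le hsR le_rfl, mul_left_comm _ 2 (‖_‖ₑ ^ 2)]
    gcongr
    exacts [lintegral_mono_set (Ioo_subset_Ioo_left hs.1.le), hs.1.le]
  have hint : V * ‖φ (c + R • (w : E))‖ₑ ^ 2 ≤ V * (2 * (K * D)) + 2 * P :=
    calc V * ‖φ (c + R • (w : E))‖ₑ ^ 2
        = ∫⁻ _ in Ioo a b, ENNReal.ofReal (a ^ m) * ‖φ (c + R • (w : E))‖ₑ ^ 2 := by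
          rw [setLIntegral_const, Real.volume_Ioo, hV, ENNReal.ofReal_mul (pow_nonneg ha.le m)]
          ring
      _ ≤ ∫⁻ s in Ioo a b, (ENNReal.ofReal (a ^ m) * (2 * (K * D)) +
            2 * (ENNReal.ofReal (s ^ m) * ‖φ (c + s • (w : E))‖ₑ ^ 2)) :=
          setLIntegral_mono' measurableSet_Ioo hpt
      _ = _ := by
          rw [lintegral_add_left measurable_const, setLIntegral_const, Real.volume_Ioo,
            lintegral_const_mul' _ _ ENNReal.ofNat_ne_top, hV,
            ENNReal.ofReal_mul (pow_nonneg ha.le m)]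
          ring
  calc ‖φ (c + R • (w : E))‖ₑ ^ 2 = V⁻¹ * (V * ‖φ (c + R • (w : E))‖ₑ ^ 2) :=
        (ENNReal.inv_mul_cancel_left hV0 ENNReal.ofReal_ne_top).symm
    _ ≤ V⁻¹ * (V * (2 * (K * D)) + 2 * P) := by gcongr
    _ = _ := by
        rw [mul_add, ENNReal.inv_mul_cancel_left hV0 ENNReal.ofReal_ne_top]
        ring

end OneDimensional

section Rays

variable {E : Type*} [NormedAddCommGroup E] [NormedSpace ℝ E]

theorem add_smul_mem_ball_of_lt {c c' w : E} {a s t : ℝ} (hc : c ∈ ball c' a) (hs : 0 ≤ s)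
    (hst : s < t) (ht : c + t • w ∈ closedBall c' a) : c + s • w ∈ ball c' a := by
  have ht0 : 0 < t := hs.trans_lt hst
  have hθ : s / t < 1 := (div_lt_one ht0).2 hst
  have hcomb : c + s • w - c' = (1 - s / t) • (c - c') + (s / t) • (c + t • w - c') := by
    have : s • w = (s / t) • t • w := by rw [smul_smul, div_mul_cancel₀ _ ht0.ne']
    rw [this]
    module
  rw [mem_ball, dist_eq_norm] at hc
  rw [mem_closedBall, dist_eq_norm] at ht
  rw [mem_ball, dist_eq_norm, hcomb]
  calc ‖(1 - s / t) • (c - c') + (s / t) • (c + t • w - c')‖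
      ≤ (1 - s / t) * ‖c - c'‖ + s / t * ‖c + t • w - c'‖ := by
        refine (norm_add_le _ _).trans_eq ?_
        rw [norm_smul, norm_smul, Real.norm_of_nonneg (by linarith),
          Real.norm_of_nonneg (by positivity)]
    _ < (1 - s / t) * a + s / t * a :=
        add_lt_add_of_lt_of_le (mul_lt_mul_of_pos_left hc (by linarith)) (by gcongr)
    _ = a := by ring

theorem exists_ray_exit {c c' : E} {a : ℝ} (hc : c ∈ ball c' a) (w : sphere (0 : E) 1) :
    ∃ ρ : ℝ, 0 < ρ ∧ c + ρ • (w : E) ∈ sphere c' a ∧ ∀ s : ℝ, 0 ≤ s →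
      (c + s • (w : E) ∈ ball c' a ↔ s < ρ) ∧ (c + s • (w : E) ∈ closedBall c' a ↔ s ≤ ρ) := by
  have ha : 0 < a := dist_nonneg.trans_lt hc
  have hfar : a ≤ dist (c + (a + a) • (w : E)) c' := by
    have hself : dist (c + (a + a) • (w : E)) c = a + a := by
      rw [dist_self_add_left, norm_smul, norm_eq_of_mem_sphere w, mul_one,
        Real.norm_of_nonneg (by positivity)]
    have := dist_triangle_right (c + (a + a) • (w : E)) c c'
    rw [mem_ball] at hc
    linarith
  obtain ⟨ρ, hρ, hρa⟩ : a ∈ (fun s : ℝ => dist (c + s • (w : E)) c') '' Icc 0 (a + a) :=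
    intermediate_value_Icc (by positivity) (by fun_prop) ⟨by simpa using hc.le, hfar⟩
  have hρ_closed : c + ρ • (w : E) ∈ closedBall c' a := hρa.le
  have hle : ∀ s : ℝ, c + s • (w : E) ∈ closedBall c' a → s ≤ ρ := fun s h =>
    not_lt.1 fun hlt => (add_smul_mem_ball_of_lt hc hρ.1 hlt h).ne hρa
  refine ⟨ρ, hρ.1.lt_of_ne ?_, hρa, fun s hs => ⟨⟨fun h => ?_, fun h => ?_⟩, hle s, fun h => ?_⟩⟩
  · rintro rfl
    exact hc.ne (by simpa using hρa)
  · exact (hle s (ball_subset_closedBall h)).lt_of_ne fun he => h.ne (he ▸ hρa)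
  · exact add_smul_mem_ball_of_lt hc hs h hρ_closed
  · rcases h.eq_or_lt with rfl | h
    exacts [hρ_closed, ball_subset_closedBall (add_smul_mem_ball_of_lt hc hs h hρ_closed)]

theorem exists_ray_annulus {c₁ c₂ : E} {R r : ℝ} (hr : 0 ≤ r) (h : closedBall c₂ r ⊆ ball c₁ R)
    (w : sphere (0 : E) 1) :
    ∃ ρ ≤ 2 * R, ∀ s : ℝ, 0 < s →
      (c₂ + s • (w : E) ∈ ball c₁ R \ closedBall c₂ r ↔ s ∈ Ioo r ρ) := by
  have hc : c₂ ∈ ball c₁ R := h (mem_closedBall_self hr)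
  obtain ⟨ρ, hρ, hmem, hexit⟩ := exists_ray_exit hc w
  refine ⟨ρ, ?_, fun s hs => ?_⟩
  · have hself : dist (c₂ + ρ • (w : E)) c₂ = ρ := by
      rw [dist_self_add_left, norm_smul, norm_eq_of_mem_sphere w, mul_one,
        Real.norm_of_nonneg hρ.le]
    have := dist_triangle_right (c₂ + ρ • (w : E)) c₂ c₁
    rw [mem_ball] at hc
    rw [mem_sphere] at hmem
    linarith
  · rw [Set.mem_sdiff, (hexit s hs.le).1, add_smul_mem_closedBall_iff c₂ hs.le, not_le, and_comm,
      mem_Ioo]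

end Rays

section SurfaceMeasure

/-- Euclidean space of dimension `n`. -/
abbrev Euc (n : ℕ) : Type := EuclideanSpace ℝ (Fin n)

/-- The surface measure of the unit sphere of `ℝⁿ`, as a measure on that sphere. -/
abbrev sphereMeasure (n : ℕ) : Measure (sphere (0 : Euc n) 1) :=
  (volume : Measure (Euc n)).toSphere

variable {n : ℕ}

theorem measurableSet_perforatedBall (c₁ : Euc n) (R : ℝ) (c₂ : Euc n) (r : ℝ) :
    MeasurableSet (perforatedBall c₁ R c₂ r) :=
  measurableSet_ball.diff measurableSet_closedBall

theorem lintegral_surfaceMeasure (c : Euc n) (ρ : ℝ) {f : Euc n → ℝ≥0∞} (hf : Measurable f) :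
    ∫⁻ x, f x ∂(surfaceMeasure c ρ) =
      ENNReal.ofReal (ρ ^ (n - 1)) * ∫⁻ w, f (c + ρ • (w : Euc n)) ∂(sphereMeasure n) := by
  rw [surfaceMeasure, lintegral_smul_measure, lintegral_map hf (by fun_prop), smul_eq_mul]

theorem lintegral_sphereMeasure {ρ : ℝ} (hρ : 0 < ρ) (c : Euc n) {f : Euc n → ℝ≥0∞}
    (hf : Measurable f) :
    ∫⁻ w, f (c + ρ • (w : Euc n)) ∂(sphereMeasure n) =
      (ENNReal.ofReal (ρ ^ (n - 1)))⁻¹ * ∫⁻ x, f x ∂(surfaceMeasure c ρ) := by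
  rw [lintegral_surfaceMeasure c ρ hf, ENNReal.inv_mul_cancel_left
    (by simpa using pow_pos hρ _) ENNReal.ofReal_ne_top]

instance (c : Euc n) (ρ : ℝ) : IsFiniteMeasure (surfaceMeasure c ρ) := by
  unfold surfaceMeasure
  exact Measure.smul_finite _ ENNReal.ofReal_ne_top

theorem ae_mem_sphere_surfaceMeasure (c : Euc n) {ρ : ℝ} (hρ : 0 ≤ ρ) :
    ∀ᵐ x ∂(surfaceMeasure c ρ), x ∈ sphere c ρ := by
  refine Measure.ae_smul_measure ?_ _
  refine (ae_map_iff (by fun_prop) isClosed_sphere.measurableSet).2 (ae_of_all _ fun y => ?_)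
  simp [norm_smul, abs_of_nonneg hρ]

variable {F : Type*} [NormedAddCommGroup F]

theorem measurable_enorm_sq {f : Euc n → F} (hf : Continuous f) :
    Measurable fun x => ‖f x‖ₑ ^ 2 :=
  hf.enorm.measurable.pow_const 2

variable [NormedSpace ℝ F] [NeZero n] {φ : Euc n → F}

theorem lintegral_sphere_sub_sq_le (hφ : ContDiff ℝ 1 φ) (c : Euc n) {a b : ℝ} (ha : 0 < a)
    (hab : a ≤ b) :
    ∫⁻ w : sphere (0 : Euc n) 1, ‖φ (c + b • (w : Euc n)) - φ (c + a • (w : Euc n))‖ₑ ^ 2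
        ∂(sphereMeasure n) ≤
      ENNReal.ofReal (radialResistance (n - 1) a b) *
        ∫⁻ x in perforatedBall c b c a, ‖fderiv ℝ φ x‖ₑ ^ 2 := by
  rw [perforatedBall, setLIntegral_annulus volume c ha.le b
      (measurable_enorm_sq (hφ.continuous_fderiv one_ne_zero)), finrank_euclideanSpace_fin,
    ← lintegral_const_mul' _ _ ENNReal.ofReal_ne_top]
  exact lintegral_mono fun w => enorm_sub_sq_le_lintegral_ray hφ (n - 1) c w ha hab

theorem exists_poincare {c₁ c₂ : Euc n} {R r : ℝ} (hr : 0 < r) (h : closedBall c₂ r ⊆ ball c₁ R) :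
    ∃ C : ℝ≥0, ∀ φ : Euc n → F, ContDiff ℝ 1 φ →
      ∫⁻ x in perforatedBall c₁ R c₂ r, ‖φ x‖ₑ ^ 2 ≤
        C * ((∫⁻ x in perforatedBall c₁ R c₂ r, ‖fderiv ℝ φ x‖ₑ ^ 2) +
          ∫⁻ x, ‖φ x‖ₑ ^ 2 ∂(surfaceMeasure c₂ r)) := by
  choose ρ hρ hray using exists_ray_annulus hr.le h
  have hpolar : ∀ {f : Euc n → ℝ≥0∞}, Measurable f → _ := fun {f} hf =>
    setLIntegral_polar volume c₂ (measurableSet_perforatedBall c₁ R c₂ r) hf (fun _ => hr.le) hray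
  set M := ENNReal.ofReal ((2 * R) ^ (n - 1) * (2 * R))
  set K := ENNReal.ofReal (radialResistance (n - 1) r (2 * R))
  set V := (ENNReal.ofReal (r ^ (n - 1)))⁻¹ with hV
  have hV_top : V ≠ ⊤ := by simpa [hV] using pow_pos hr _
  have hC : M * (2 * V + 2 * K) ≠ ⊤ := by finiteness
  refine ⟨(M * (2 * V + 2 * K)).toNNReal, fun φ hφ => ?_⟩
  rw [ENNReal.coe_toNNReal hC]
  have hm := measurable_enorm_sq hφ.continuous
  have hm_inner : Measurable fun w : sphere (0 : Euc n) 1 => ‖φ (c₂ + r • (w : Euc n))‖ₑ ^ 2 :=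
    hm.comp (by fun_prop)
  set D := ∫⁻ x in perforatedBall c₁ R c₂ r, ‖fderiv ℝ φ x‖ₑ ^ 2 with hD
  set S := ∫⁻ x, ‖φ x‖ₑ ^ 2 ∂(surfaceMeasure c₂ r)
  calc ∫⁻ x in perforatedBall c₁ R c₂ r, ‖φ x‖ₑ ^ 2
      ≤ M * (2 * (V * S) + 2 * K * D) := by
        rw [hD, hpolar hm, hpolar (measurable_enorm_sq (hφ.continuous_fderiv one_ne_zero)),
          finrank_euclideanSpace_fin, ← lintegral_sphereMeasure hr c₂ hm,
          ← lintegral_const_mul' _ _ ENNReal.ofNat_ne_top,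
          ← lintegral_const_mul' _ _ (by finiteness), ← lintegral_add_left (hm_inner.const_mul 2),
          ← lintegral_const_mul' _ _ ENNReal.ofReal_ne_top]
        exact lintegral_mono fun w => setLIntegral_ray_enorm_sq_le hφ (n - 1) c₂ w hr (hρ w)
    _ ≤ M * (2 * V * (D + S) + 2 * K * (D + S)) := by
        rw [← mul_assoc 2]
        gcongr
        exacts [le_add_self, le_self_add]
    _ = M * (2 * V + 2 * K) * (D + S) := by ring

theorem lintegral_sphere_sq_le (hφ : ContDiff ℝ 1 φ) (c : Euc n) {a b R : ℝ} (ha : 0 < a)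
    (hab : a < b) (hbR : b ≤ R) :
    ∫⁻ w : sphere (0 : Euc n) 1, ‖φ (c + R • (w : Euc n))‖ₑ ^ 2 ∂(sphereMeasure n) ≤
      2 * ENNReal.ofReal (radialResistance (n - 1) a R) *
          (∫⁻ x in perforatedBall c R c a, ‖fderiv ℝ φ x‖ₑ ^ 2) +
        2 * (ENNReal.ofReal (a ^ (n - 1) * (b - a)))⁻¹ *
          ∫⁻ x in perforatedBall c b c a, ‖φ x‖ₑ ^ 2 := by
  have hV : (ENNReal.ofReal (a ^ (n - 1) * (b - a)))⁻¹ ≠ ⊤ := by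
    simpa using mul_pos (pow_pos ha (n - 1)) (sub_pos.2 hab)
  have hm := measurable_enorm_sq (hφ.continuous_fderiv one_ne_zero)
  have hmeas : Measurable fun w : sphere (0 : Euc n) 1 => ∫⁻ s in Ioo a R,
      ENNReal.ofReal (s ^ (n - 1)) * ‖fderiv ℝ φ (c + s • (w : Euc n))‖ₑ ^ 2 :=
    Measurable.lintegral_prod_right' (f := fun p : sphere (0 : Euc n) 1 × ℝ =>
      ENNReal.ofReal (p.2 ^ (n - 1)) * ‖fderiv ℝ φ (c + p.2 • (p.1 : Euc n))‖ₑ ^ 2)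
      (.mul (by fun_prop) (hm.comp (by fun_prop)))
  rw [perforatedBall, setLIntegral_annulus volume c ha.le R hm, perforatedBall,
    setLIntegral_annulus volume c ha.le b (measurable_enorm_sq hφ.continuous),
    finrank_euclideanSpace_fin, ← lintegral_const_mul' _ _ (by finiteness),
    ← lintegral_const_mul' _ _ (by finiteness), ← lintegral_add_left (hmeas.const_mul _)]
  exact lintegral_mono fun w => enorm_sq_ray_le hφ (n - 1) c w ha hab hbR

end SurfaceMeasure

section FiniteAverages

variable {E F : Type*} [NormedAddCommGroup E] [MeasurableSpace E] [BorelSpace E]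
  [NormedAddCommGroup F] {μ : Measure E} {φ : E → F} {A Ω : Set E} {δ : ℝ}

theorem setLIntegral_ball_sub_sq_le [μ.IsAddRightInvariant] {c x : E} (hx : x ∈ ball c δ) :
    ∫⁻ y in ball c δ, ‖φ x - φ y‖ₑ ^ 2 ∂μ ≤
      ∫⁻ h in ball 0 (2 * δ), ‖φ (x + h) - φ x‖ₑ ^ 2 ∂μ := by
  have hsub : ball c δ ⊆ (· - x) ⁻¹' ball 0 (2 * δ) := fun y hy => by
    have := dist_triangle_right y x c
    rw [mem_ball] at hx hy
    rw [mem_preimage, mem_ball_zero_iff, ← dist_eq_norm]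
    linarith
  calc ∫⁻ y in ball c δ, ‖φ x - φ y‖ₑ ^ 2 ∂μ
      ≤ ∫⁻ y in (· - x) ⁻¹' ball 0 (2 * δ), ‖φ x - φ y‖ₑ ^ 2 ∂μ := lintegral_mono_set hsub
    _ = _ := by
        simpa [enorm_sub_rev] using (measurePreserving_sub_right μ x).setLIntegral_comp_preimage_emb
          (Homeomorph.subRight x).measurableEmbedding (fun h => ‖φ (x + h) - φ x‖ₑ ^ 2)
          (ball 0 (2 * δ))

variable [NormedSpace ℝ E] [FiniteDimensional ℝ E] [NormedSpace ℝ F] [μ.IsAddHaarMeasure]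

theorem setLIntegral_add_sub_sq_le (hφ : ContDiff ℝ 1 φ) {h : E}
    (hA : ∀ x ∈ A, ∀ s ∈ Ioo (0 : ℝ) 1, x + s • h ∈ Ω) (hAm : MeasurableSet A) :
    ∫⁻ x in A, ‖φ (x + h) - φ x‖ₑ ^ 2 ∂μ ≤ ‖h‖ₑ ^ 2 * ∫⁻ x in Ω, ‖fderiv ℝ φ x‖ₑ ^ 2 ∂μ := by
  have hm : Measurable fun p : E × ℝ => ‖fderiv ℝ φ (p.1 + p.2 • h)‖ₑ ^ 2 :=
    ((hφ.continuous_fderiv one_ne_zero).comp (by fun_prop)).enorm.measurable.pow_const 2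
  have htranslate : ∀ s ∈ Ioo (0 : ℝ) 1, ∫⁻ x in A, ‖fderiv ℝ φ (x + s • h)‖ₑ ^ 2 ∂μ ≤
      ∫⁻ x in Ω, ‖fderiv ℝ φ x‖ₑ ^ 2 ∂μ := fun s hs =>
    calc ∫⁻ x in A, ‖fderiv ℝ φ (x + s • h)‖ₑ ^ 2 ∂μ
        ≤ ∫⁻ x in (· + s • h) ⁻¹' Ω, ‖fderiv ℝ φ (x + s • h)‖ₑ ^ 2 ∂μ :=
          lintegral_mono_set fun x hx => hA x hx s hs
      _ = _ := (measurePreserving_add_right μ (s • h)).setLIntegral_comp_preimage_emb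
          (Homeomorph.addRight (s • h)).measurableEmbedding (fun x => ‖fderiv ℝ φ x‖ₑ ^ 2) Ω
  calc ∫⁻ x in A, ‖φ (x + h) - φ x‖ₑ ^ 2 ∂μ
      ≤ ∫⁻ x in A, ‖h‖ₑ ^ 2 * (∫⁻ s in Ioo (0 : ℝ) 1, ‖fderiv ℝ φ (x + s • h)‖ₑ ^ 2) ∂μ :=
        setLIntegral_mono' hAm fun x _ => enorm_add_sub_sq_le_lintegral hφ x h
    _ = ‖h‖ₑ ^ 2 * ∫⁻ s in Ioo (0 : ℝ) 1, (∫⁻ x in A, ‖fderiv ℝ φ (x + s • h)‖ₑ ^ 2 ∂μ) := by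
        rw [lintegral_const_mul' _ _ (by finiteness), lintegral_lintegral_swap hm.aemeasurable]
    _ ≤ ‖h‖ₑ ^ 2 * ∫⁻ _ in Ioo (0 : ℝ) 1, (∫⁻ x in Ω, ‖fderiv ℝ φ x‖ₑ ^ 2 ∂μ) := by
        gcongr _ * ?_
        exact setLIntegral_mono' measurableSet_Ioo htranslate
    _ = _ := by simp

theorem setLIntegral_setLIntegral_ball_add_sub_sq_le (hφ : ContDiff ℝ 1 φ)
    (hA : thickening δ A ⊆ Ω) (hAm : MeasurableSet A) :
    ∫⁻ x in A, (∫⁻ h in ball 0 δ, ‖φ (x + h) - φ x‖ₑ ^ 2 ∂μ) ∂μ ≤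
      ENNReal.ofReal δ ^ 2 * μ (ball 0 δ) * ∫⁻ x in Ω, ‖fderiv ℝ φ x‖ₑ ^ 2 ∂μ := by
  have hm : Measurable fun p : E × E => ‖φ (p.1 + p.2) - φ p.1‖ₑ ^ 2 :=
    ((hφ.continuous.comp (by fun_prop)).sub
      (hφ.continuous.comp (by fun_prop))).enorm.measurable.pow_const 2
  have hball : ∀ h ∈ ball (0 : E) δ, ∫⁻ x in A, ‖φ (x + h) - φ x‖ₑ ^ 2 ∂μ ≤
      ENNReal.ofReal δ ^ 2 * ∫⁻ x in Ω, ‖fderiv ℝ φ x‖ₑ ^ 2 ∂μ := fun h hh => by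
    rw [mem_ball_zero_iff] at hh
    refine (setLIntegral_add_sub_sq_le hφ (fun x hx s hs => hA ?_) hAm).trans ?_
    · refine mem_thickening_iff.2 ⟨x, hx, ?_⟩
      rw [dist_self_add_left, norm_smul, Real.norm_of_nonneg hs.1.le]
      exact (mul_le_of_le_one_left (norm_nonneg h) hs.2.le).trans_lt hh
    · rw [← ofReal_norm]
      gcongr
  rw [lintegral_lintegral_swap hm.aemeasurable]
  refine (setLIntegral_mono' measurableSet_ball hball).trans_eq ?_
  rw [setLIntegral_const]
  ring

theorem sq_measure_ball_mul_enorm_sq_le [CompleteSpace F] (hφ : Continuous φ) {c x : E}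
    (hx : x ∈ ball c δ) :
    μ (ball 0 δ) ^ 2 * ‖φ x‖ₑ ^ 2 ≤ 2 * ‖∫ y in ball c δ, φ y ∂μ‖ₑ ^ 2 +
      2 * μ (ball 0 δ) * ∫⁻ h in ball 0 (2 * δ), ‖φ (x + h) - φ x‖ₑ ^ 2 ∂μ := by
  have hint : IntegrableOn φ (ball c δ) μ :=
    (hφ.continuousOn.integrableOn_compact (isCompact_closedBall c δ)).mono_set
      ball_subset_closedBall
  have hintc : IntegrableOn (fun _ => φ x) (ball c δ) μ :=
    integrableOn_const measure_ball_lt_top.ne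
  have hV : μ (ball c δ) = μ (ball 0 δ) := Measure.addHaar_ball_center μ c δ
  have hconst : ‖∫ _ in ball c δ, φ x ∂μ‖ₑ = μ (ball 0 δ) * ‖φ x‖ₑ := by
    rw [setIntegral_const, enorm_smul, Real.enorm_of_nonneg measureReal_nonneg, ofReal_measureReal,
      hV]
  have hmean : ‖(∫ _ in ball c δ, φ x ∂μ) - ∫ y in ball c δ, φ y ∂μ‖ₑ ^ 2 ≤
      μ (ball 0 δ) * ∫⁻ h in ball 0 (2 * δ), ‖φ (x + h) - φ x‖ₑ ^ 2 ∂μ :=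
    calc _ ≤ (∫⁻ y in ball c δ, ‖φ x - φ y‖ₑ ∂μ) ^ 2 := by
          rw [← integral_sub hintc hint]
          gcongr
          exact enorm_integral_le_lintegral_enorm _
      _ ≤ μ (ball 0 δ) * ∫⁻ y in ball c δ, ‖φ x - φ y‖ₑ ^ 2 ∂μ := by
          simpa [hV] using sq_lintegral_le_lintegral_inv_mul (μ := μ.restrict (ball c δ))
            (v := fun _ => 1) (continuous_const.sub hφ).enorm.measurable.aemeasurable
            aemeasurable_const (by simp) (by simp)
      _ ≤ _ := by gcongr _ * ?_; exact setLIntegral_ball_sub_sq_le hx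
  rw [← mul_pow, ← hconst]
  grw [enorm_sq_le_two_mul _ (∫ y in ball c δ, φ y ∂μ), hmean]
  rw [add_comm, mul_assoc]

theorem sq_measure_ball_mul_setLIntegral_sq_le [CompleteSpace F] (hφ : ContDiff ℝ 1 φ)
    {t : Finset E} (hcover : A ⊆ ⋃ c ∈ t, ball c δ) (hAm : MeasurableSet A)
    (hΩ : thickening (2 * δ) A ⊆ Ω) :
    μ (ball 0 δ) ^ 2 * ∫⁻ x in A, ‖φ x‖ₑ ^ 2 ∂μ ≤
      2 * μ A * (∑ c ∈ t, ‖∫ x in ball c δ, φ x ∂μ‖ₑ ^ 2) +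
        2 * ENNReal.ofReal (2 * δ) ^ 2 * μ (ball 0 δ) * μ (ball 0 (2 * δ)) *
          ∫⁻ x in Ω, ‖fderiv ℝ φ x‖ₑ ^ 2 ∂μ := by
  have hV : μ (ball (0 : E) δ) ≠ ⊤ := measure_ball_lt_top.ne
  set S := ∑ c ∈ t, ‖∫ x in ball c δ, φ x ∂μ‖ₑ ^ 2
  have hpt : ∀ x ∈ A, μ (ball 0 δ) ^ 2 * ‖φ x‖ₑ ^ 2 ≤ 2 * S +
      2 * μ (ball 0 δ) * ∫⁻ h in ball 0 (2 * δ), ‖φ (x + h) - φ x‖ₑ ^ 2 ∂μ := fun x hx => by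
    obtain ⟨c, hc, hxc⟩ := mem_iUnion₂.1 (hcover hx)
    grw [sq_measure_ball_mul_enorm_sq_le hφ.continuous hxc]
    gcongr
    exact Finset.single_le_sum (f := fun c => ‖∫ x in ball c δ, φ x ∂μ‖ₑ ^ 2)
      (fun _ _ => zero_le) hc
  rw [← lintegral_const_mul' _ _ (by finiteness)]
  grw [setLIntegral_mono' hAm hpt]
  rw [lintegral_add_left measurable_const, setLIntegral_const,
    lintegral_const_mul' _ _ (by finiteness)]
  grw [setLIntegral_setLIntegral_ball_add_sub_sq_le hφ hΩ hAm]
  exact (by ring : _ = _).le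

theorem exists_setLIntegral_sq_le_averages [Nontrivial E] [CompleteSpace F]
    (hA : Bornology.IsBounded A) (hAm : MeasurableSet A) (hδ : 0 < δ)
    (hΩ : thickening (2 * δ) A ⊆ Ω) :
    ∃ (t : Finset E) (C : ℝ≥0), (∀ c ∈ t, ball c δ ⊆ Ω) ∧ ∀ φ : E → F, ContDiff ℝ 1 φ →
      ∫⁻ x in A, ‖φ x‖ₑ ^ 2 ∂μ ≤
        ENNReal.ofReal (2 ^ (Module.finrank ℝ E + 3) * δ ^ 2) *
          (∫⁻ x in Ω, ‖fderiv ℝ φ x‖ₑ ^ 2 ∂μ) +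
        C * ∑ c ∈ t, ‖∫ x in ball c δ, φ x ∂μ‖ₑ ^ 2 := by
  obtain ⟨t, htA, htfin, hcover⟩ := finite_approx_of_totallyBounded
    (hA.isCompact_closure.totallyBounded.subset subset_closure) δ hδ
  lift t to Finset E using htfin
  set V := μ (ball (0 : E) δ)
  have hV0 : V ≠ 0 := (measure_ball_pos μ 0 hδ).ne'
  have hV : V ≠ ⊤ := measure_ball_lt_top.ne
  have hμA : μ A ≠ ⊤ := hA.measure_lt_top.ne
  have hC : (V ^ 2)⁻¹ * 2 * μ A ≠ ⊤ := by finiteness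
  refine ⟨t, ((V ^ 2)⁻¹ * 2 * μ A).toNNReal, fun c hc => ?_, fun φ hφ => ?_⟩
  · refine Subset.trans ?_ ((ball_subset_thickening (htA hc) _).trans hΩ)
    exact ball_subset_ball (by linarith)
  have hcancel : (V ^ 2)⁻¹ * V ^ 2 = 1 := ENNReal.inv_mul_cancel (by positivity) (by finiteness)
  have hconst : 2 * ENNReal.ofReal (2 * δ) ^ 2 * ENNReal.ofReal (2 ^ Module.finrank ℝ E) =
      ENNReal.ofReal (2 ^ (Module.finrank ℝ E + 3) * δ ^ 2) := by
    rw [← ENNReal.ofReal_ofNat 2, ← ENNReal.ofReal_pow (by positivity),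
      ← ENNReal.ofReal_mul (by positivity), ← ENNReal.ofReal_mul (by positivity)]
    ring_nf
  rw [ENNReal.coe_toNNReal hC, ← one_mul (∫⁻ x in A, _ ∂μ), ← hcancel, mul_assoc]
  grw [sq_measure_ball_mul_setLIntegral_sq_le hφ hcover hAm hΩ,
    Measure.addHaar_ball_mul μ 0 zero_le_two]
  set S := ∑ c ∈ t, ‖∫ x in ball c δ, φ x ∂μ‖ₑ ^ 2
  set G := ∫⁻ x in Ω, ‖fderiv ℝ φ x‖ₑ ^ 2 ∂μ
  refine le_of_eq ?_
  calc _ = (V ^ 2)⁻¹ * V ^ 2 *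
          (2 * ENNReal.ofReal (2 * δ) ^ 2 * ENNReal.ofReal (2 ^ Module.finrank ℝ E)) * G +
        (V ^ 2)⁻¹ * 2 * μ A * S := by ring
    _ = _ := by rw [hcancel, one_mul, hconst]

end FiniteAverages

section TraceCompactness

theorem radialResistance_le (m : ℕ) {a b : ℝ} (ha : 0 < a) (hab : a ≤ b) :
    radialResistance m a b ≤ (a ^ m)⁻¹ * (b - a) := by
  have hmono : radialResistance m a b ≤ ∫ _ in a..b, (a ^ m)⁻¹ :=
    intervalIntegral.integral_mono_on hab (intervalIntegrable_inv_pow m ha (ha.trans_le hab))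
      intervalIntegrable_const fun s hs => inv_anti₀ (pow_pos ha m) (pow_le_pow_left₀ ha.le hs.1 m)
  rwa [intervalIntegral.integral_const, smul_eq_mul, mul_comm] at hmono

theorem exists_radialResistance_lt (m : ℕ) {R ρ ε : ℝ} (hR : 0 < R) (hρ : ρ < R) (hε : 0 < ε) :
    ∃ a ∈ Ioo (max ρ 0) R, radialResistance m a R < ε := by
  have hlim : Tendsto (fun a : ℝ => (a ^ m)⁻¹ * (R - a)) (𝓝[<] R) (𝓝 0) := by
    have hcont : ContinuousAt (fun a : ℝ => (a ^ m)⁻¹ * (R - a)) R :=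
      ContinuousAt.mul (.inv₀ (by fun_prop) (pow_pos hR m).ne') (by fun_prop)
    simpa using hcont.tendsto.mono_left nhdsWithin_le_nhds
  obtain ⟨a, ha, hlt⟩ := (Filter.Eventually.and (Ioo_mem_nhdsLT (max_lt hρ hR))
    (hlim.eventually (gt_mem_nhds hε))).exists
  exact ⟨a, ha, (radialResistance_le m ((le_max_right _ _).trans_lt ha.1) ha.2.le).trans_lt hlt⟩

variable {n : ℕ}

theorem thickening_perforatedBall_subset {c c' : Euc n} {a b r R ρ δ : ℝ}
    (h : closedBall c' r ⊆ ball c ρ) (ha : ρ + δ ≤ a) (hb : b + δ ≤ R) :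
    thickening δ (perforatedBall c b c a) ⊆ perforatedBall c R c' r := by
  intro y hy
  obtain ⟨x, ⟨hxb, hxa⟩, hyx⟩ := mem_thickening_iff.1 hy
  rw [mem_ball] at hxb
  rw [mem_closedBall, not_le] at hxa
  refine ⟨?_, fun hy' => ?_⟩
  · rw [mem_ball]
    linarith [dist_triangle y x c]
  · have := mem_ball.1 (h hy')
    linarith [dist_triangle_left x c y]

variable {F : Type*} [NormedAddCommGroup F] [NormedSpace ℝ F] [CompleteSpace F] [NeZero n]

theorem exists_setLIntegral_annulus_sq_le_averages {c₁ c₂ : Euc n} {R r ρ a b ε : ℝ}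
    (h : closedBall c₂ r ⊆ ball c₁ ρ) (hρa : ρ < a) (hbR : b < R) (hε : 0 < ε) :
    ∃ (t : Finset (Euc n)) (δ : ℝ) (C : ℝ≥0), (∀ c ∈ t, ball c δ ⊆ perforatedBall c₁ R c₂ r) ∧
      ∀ φ : Euc n → F, ContDiff ℝ 1 φ → ∫⁻ x in perforatedBall c₁ b c₁ a, ‖φ x‖ₑ ^ 2 ≤
        ENNReal.ofReal ε * (∫⁻ x in perforatedBall c₁ R c₂ r, ‖fderiv ℝ φ x‖ₑ ^ 2) +
          C * ∑ c ∈ t, ‖∫ x in ball c δ, φ x‖ₑ ^ 2 := by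
  obtain ⟨δ, ⟨hδρ, hδR, hδε⟩, hδ⟩ : ∃ δ : ℝ, (ρ + 2 * δ ≤ a ∧ b + 2 * δ ≤ R ∧
      2 ^ (n + 3) * δ ^ 2 ≤ ε) ∧ 0 < δ := by
    have hsmall {f : ℝ → ℝ} {y : ℝ} (hf : Continuous f) (hy : f 0 < y) :
        ∀ᶠ δ in 𝓝[>] 0, f δ ≤ y :=
      ((hf.tendsto 0).mono_left nhdsWithin_le_nhds).eventually_le_const hy
    exact ((hsmall (by fun_prop) (by simpa)).and ((hsmall (by fun_prop) (by simpa)).and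
      (hsmall (by fun_prop) (by simpa)))).and self_mem_nhdsWithin |>.exists
  obtain ⟨t, C, htΩ, ht⟩ := exists_setLIntegral_sq_le_averages (F := F) (μ := volume)
    (A := perforatedBall c₁ b c₁ a) (isBounded_ball.subset sdiff_subset)
    (measurableSet_perforatedBall c₁ b c₁ a) hδ (thickening_perforatedBall_subset h hδρ hδR)
  rw [finrank_euclideanSpace_fin] at ht
  exact ⟨t, δ, C, htΩ, fun φ hφ => by grw [ht φ hφ, hδε]⟩

theorem exists_trace_sq_le_averages {c₁ c₂ : Euc n} {R r ε : ℝ} (hR : 0 < R)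
    (h : closedBall c₂ r ⊆ ball c₁ R) (hε : 0 < ε) :
    ∃ (t : Finset (Euc n)) (δ : ℝ) (C : ℝ≥0), (∀ c ∈ t, ball c δ ⊆ perforatedBall c₁ R c₂ r) ∧
      ∀ φ : Euc n → F, ContDiff ℝ 1 φ → ∫⁻ x, ‖φ x‖ₑ ^ 2 ∂(surfaceMeasure c₁ R) ≤
        ENNReal.ofReal ε * (∫⁻ x in perforatedBall c₁ R c₂ r, ‖fderiv ℝ φ x‖ₑ ^ 2) +
          C * ∑ c ∈ t, ‖∫ x in ball c δ, φ x‖ₑ ^ 2 := by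
  set P := R ^ (n - 1)
  have hP : 0 < P := pow_pos hR _
  obtain ⟨ρ, hρR, hρ⟩ := exists_lt_subset_ball isClosed_closedBall h
  obtain ⟨a, ⟨ha, haR⟩, hres⟩ := exists_radialResistance_lt (n - 1) hR hρR
    (ε := ε / (4 * P)) (by positivity)
  obtain ⟨hρa, ha0⟩ := max_lt_iff.1 ha
  obtain ⟨b, hab, hbR⟩ := exists_between haR
  have hV : 0 < a ^ (n - 1) * (b - a) := mul_pos (pow_pos ha0 _) (sub_pos.2 hab)
  set W := P * (2 * (a ^ (n - 1) * (b - a))⁻¹) with hW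
  have hW0 : 0 < W := by positivity
  obtain ⟨t, δ, C, htΩ, ht⟩ := exists_setLIntegral_annulus_sq_le_averages (F := F) hρ hρa hbR
    (ε := ε / (2 * W)) (by positivity)
  have hsub : perforatedBall c₁ R c₁ a ⊆ perforatedBall c₁ R c₂ r :=
    sdiff_subset_sdiff_right (hρ.trans ((ball_subset_ball hρa.le).trans ball_subset_closedBall))
  have hcoef : P * (2 * radialResistance (n - 1) a R) + W * (ε / (2 * W)) ≤ ε := by
    rw [lt_div_iff₀ (by positivity)] at hres
    have : W * (ε / (2 * W)) = ε / 2 := by field_simp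
    linarith
  have hres0 := (radialResistance_pos (n - 1) ha0 haR).le
  refine ⟨t, δ, W.toNNReal * C, htΩ, fun φ hφ => ?_⟩
  rw [lintegral_surfaceMeasure c₁ R (measurable_enorm_sq hφ.continuous)]
  grw [lintegral_sphere_sq_le hφ c₁ ha0 hab hbR.le, ht φ hφ, lintegral_mono_set hsub, ← hcoef]
  rw [← ENNReal.ofReal_inv_of_pos hV, ENNReal.ofReal_add (by positivity) (by positivity),
    ENNReal.ofReal_mul hW0.le, ENNReal.ofReal_mul hP.le, ENNReal.ofReal_mul zero_le_two,
    ENNReal.ofReal_ofNat, ENNReal.coe_mul, ← ENNReal.ofReal, hW, ENNReal.ofReal_mul hP.le,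
    ENNReal.ofReal_mul zero_le_two, ENNReal.ofReal_ofNat]
  exact (by ring : _ = _).le

end TraceCompactness

section Operators

variable {X Y Z : Type*} [NormedAddCommGroup Z] [CompleteSpace Z]

theorem isCompactOperator_of_norm_sq_le_add [NormedAddCommGroup X] [NormedSpace ℝ X]
    [NormedSpace ℝ Z] (T : X →L[ℝ] Z)
    (h : ∀ ε > 0, ∃ (W : Type) (_ : NormedAddCommGroup W) (_ : NormedSpace ℝ W)
      (_ : FiniteDimensional ℝ W) (L : X →L[ℝ] W), ∀ x, ‖T x‖ ^ 2 ≤ ε * ‖x‖ ^ 2 + ‖L x‖ ^ 2) :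
    IsCompactOperator T := by
  refine (isCompactOperator_iff_isCompact_closure_image_ball (T : X →ₛₗ[RingHom.id ℝ] Z)
    one_pos).2 ((TotallyBounded.closure ?_).isCompact_of_isClosed isClosed_closure)
  rw [Metric.totallyBounded_iff]
  intro ε hε
  obtain ⟨W, _, _, _, L, hT⟩ := h (ε ^ 2 / 8) (by positivity)
  have hproper : ProperSpace W := FiniteDimensional.proper ℝ W
  have hL : TotallyBounded (L '' ball 0 1) :=
    (L.lipschitz.isBounded_image isBounded_ball).isCompact_closure.totallyBounded.subset
      subset_closure
  obtain ⟨s, hsub, hs, hcover⟩ :=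
    totallyBounded_iff_subset.1 hL _ (dist_mem_uniformity (half_pos hε))
  choose! p hp hLp using fun w (hw : w ∈ s) => hsub hw
  refine ⟨(fun w => T (p w)) '' s, hs.image _, ?_⟩
  rintro _ ⟨x, hx, rfl⟩
  obtain ⟨w, hw, hdist⟩ := mem_iUnion₂.1 (hcover ⟨x, hx, rfl⟩)
  refine mem_iUnion₂.2 ⟨_, ⟨w, hw, rfl⟩, ?_⟩
  have hLsub : ‖L (x - p w)‖ < ε / 2 := by
    rwa [map_sub, hLp w hw, ← dist_eq_norm]
  have hsub : ‖x - p w‖ ≤ 2 := by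
    have := norm_sub_le x (p w)
    linarith [mem_ball_zero_iff.1 hx, mem_ball_zero_iff.1 (hp w hw)]
  change dist (T x) (T (p w)) < ε
  rw [dist_eq_norm, ← map_sub]
  refine lt_of_pow_lt_pow_left₀ 2 hε.le ?_
  calc ‖T (x - p w)‖ ^ 2 ≤ ε ^ 2 / 8 * ‖x - p w‖ ^ 2 + ‖L (x - p w)‖ ^ 2 := hT _
    _ ≤ ε ^ 2 / 8 * 2 ^ 2 + (ε / 2) ^ 2 := by gcongr
    _ < ε ^ 2 := by linarith [pow_pos hε 2]

variable [InnerProductSpace ℝ Z]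

theorem exists_inner_eq_norm_sq_mul_inner [NormedAddCommGroup X] [InnerProductSpace ℝ X]
    [CompleteSpace X] {A : X →L[ℝ] Z} (hA : IsCompactOperator A) (hA0 : A ≠ 0) :
    ∃ x ≠ 0, ∀ y, inner ℝ (A x) (A y) = ‖A‖ ^ 2 * inner ℝ x y := by
  set S : X →L[ℝ] X := A.adjoint ∘L A
  have hSA (x y : X) : inner ℝ (S x) y = inner ℝ (A x) (A y) := A.adjoint_inner_left y (A x)
  have hnorm : ‖S‖ = ‖A‖ ^ 2 := by rw [sq, ← A.norm_adjoint_comp_self]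
  have hrad : spectralRadius ℝ S = ‖S‖₊ :=
    S.spectralRadius_eq_nnnorm A.isPositive_adjoint_comp_self.isSelfAdjoint
  have hS0 : S ≠ 0 := norm_ne_zero_iff.1 (hnorm ▸ by positivity)
  have hspec : (spectrum ℝ S).Nonempty := by
    by_contra! hempty
    exact hS0 (nnnorm_eq_zero.1 (by simpa [spectralRadius, hempty] using hrad.symm))
  obtain ⟨τ, hτ, hτS⟩ := spectrum.exists_nnnorm_eq_spectralRadius_of_nonempty hspec
  have hτA : ‖τ‖ = ‖A‖ ^ 2 := by
    rw [← hnorm, ← coe_nnnorm, ← coe_nnnorm S, ENNReal.coe_inj.1 (hτS.trans hrad)]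
  have hτ0 : τ ≠ 0 := norm_ne_zero_iff.1 (hτA ▸ by positivity)
  obtain ⟨x, hx, hx0⟩ := (((hA.clm_comp A.adjoint).hasEigenvalue_iff_mem_spectrum hτ0).2
    hτ).exists_hasEigenvector
  have hSx : S x = τ • x := Module.End.mem_eigenspace_iff.1 hx
  have hτx (y : X) : inner ℝ (A x) (A y) = τ * inner ℝ x y := by
    rw [← hSA, hSx, real_inner_smul_left]
  have hτpos : 0 ≤ τ := by
    refine nonneg_of_mul_nonneg_left (a := τ) (b := ‖x‖ ^ 2) ?_ (by positivity)
    rw [← real_inner_self_eq_norm_sq, ← hτx]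
    exact real_inner_self_nonneg
  exact ⟨x, hx0, fun y => by rw [hτx, ← hτA, Real.norm_of_nonneg hτpos]⟩

theorem exists_inner_eq_mul_inner [NormedAddCommGroup X] [NormedSpace ℝ X] [CompleteSpace X]
    [NormedAddCommGroup Y] [InnerProductSpace ℝ Y] [CompleteSpace Y] {g : X →L[ℝ] Y} {C : ℝ≥0}
    (hg : AntilipschitzWith C g) {T : X →L[ℝ] Z} (hT : IsCompactOperator T) (hT0 : T ≠ 0) :
    ∃ m > 0, (∀ y, ‖T y‖ ^ 2 ≤ m * ‖g y‖ ^ 2) ∧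
      ∃ x ≠ 0, ∀ y, inner ℝ (T x) (T y) = m * inner ℝ (g x) (g y) := by
  have hclosed : IsClosed (range g) := hg.isClosed_range g.uniformContinuous
  have : CompleteSpace g.range := hclosed.completeSpace_coe
  let e := g.equivRange hg.injective hclosed
  let A : g.range →L[ℝ] Z := T ∘L e.symm.toContinuousLinearMap
  have hAe (y : X) : A (e y) = T y := congrArg T (e.symm_apply_apply y)
  have hA0 : A ≠ 0 := fun h => hT0 <| ContinuousLinearMap.ext fun y => by
    rw [← hAe, h]; rfl
  obtain ⟨z, hz, hzA⟩ := exists_inner_eq_norm_sq_mul_inner (A := A) (hT.comp_clm _) hA0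
  refine ⟨‖A‖ ^ 2, by positivity, fun y => ?_, e.symm z, by simpa using hz, fun y => ?_⟩
  · rw [← hAe, ← mul_pow]
    gcongr
    exact A.le_opNorm (e y)
  · have hz : g (e.symm z) = z := congrArg Subtype.val (e.apply_symm_apply z)
    rw [← hAe y, ← hAe (e.symm z), e.apply_symm_apply, hzA, hz]
    rfl

end Operators

section RadialPotential

/-- A smooth function on `ℝ` that agrees with `s ↦ s ^ (-m)` for `s ≥ r / 2` and vanishes for
`s ≤ r / 4`. -/
def truncatedInvPow (m : ℕ) (r s : ℝ) : ℝ :=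
  Real.smoothTransition (4 / r * s - 1) * (s ^ m)⁻¹

variable (m : ℕ) {r s : ℝ}

theorem truncatedInvPow_eq_inv_pow (hr : 0 < r) (hs : r / 2 ≤ s) :
    truncatedInvPow m r s = (s ^ m)⁻¹ := by
  rw [truncatedInvPow, Real.smoothTransition.one_of_one_le, one_mul]
  rw [le_sub_iff_add_le, div_mul_eq_mul_div, le_div_iff₀ hr]
  linarith

theorem truncatedInvPow_eq_zero (hr : 0 < r) (hs : s ≤ r / 4) : truncatedInvPow m r s = 0 := by
  rw [truncatedInvPow, Real.smoothTransition.zero_of_nonpos, zero_mul]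
  rw [sub_nonpos, div_mul_eq_mul_div, div_le_iff₀ hr]
  linarith

theorem contDiff_truncatedInvPow (hr : 0 < r) : ContDiff ℝ ∞ (truncatedInvPow m r) := by
  refine contDiff_iff_contDiffAt.2 fun s => ?_
  rcases eq_or_ne s 0 with rfl | hs
  · have hzero : truncatedInvPow m r =ᶠ[𝓝 0] fun _ => 0 := by
      filter_upwards [gt_mem_nhds (show (0 : ℝ) < r / 4 by positivity)] with s hs
      exact truncatedInvPow_eq_zero m hr hs.le
    exact contDiffAt_const.congr_of_eventuallyEq hzero
  · exact (Real.smoothTransition.contDiff.contDiffAt.comp s (by fun_prop)).mul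
      (ContDiffAt.inv (by fun_prop) (pow_ne_zero _ hs))

/-- A smooth function on `ℝ` that agrees with `radialResistance m r` for `s ≥ r / 2` and is constant
for `s ≤ r / 4`. -/
def radialProfile (m : ℕ) (r s : ℝ) : ℝ :=
  ∫ t in r..s, truncatedInvPow m r t

theorem hasDerivAt_radialProfile (hr : 0 < r) (s : ℝ) :
    HasDerivAt (radialProfile m r) (truncatedInvPow m r s) s :=
  (contDiff_truncatedInvPow m hr).continuous.integral_hasStrictDerivAt r s |>.hasDerivAt

theorem contDiff_radialProfile (hr : 0 < r) : ContDiff ℝ ∞ (radialProfile m r) := by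
  rw [contDiff_infty_iff_deriv,
    show deriv (radialProfile m r) = truncatedInvPow m r from
      funext fun s => (hasDerivAt_radialProfile m hr s).deriv]
  exact ⟨fun s => (hasDerivAt_radialProfile m hr s).differentiableAt, contDiff_truncatedInvPow m hr⟩

theorem radialProfile_eq_radialResistance (hr : 0 < r) (hs : r / 2 ≤ s) :
    radialProfile m r s = radialResistance m r s :=
  intervalIntegral.integral_congr fun _ ht =>
    truncatedInvPow_eq_inv_pow m hr ((le_min (by linarith) hs).trans ht.1)

theorem radialProfile_eq_of_le (hr : 0 < r) (hs : s ≤ r / 4) :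
    radialProfile m r s = radialProfile m r (r / 4) := by
  have hi : ∀ a b, IntervalIntegrable (truncatedInvPow m r) volume a b :=
    (contDiff_truncatedInvPow m hr).continuous.intervalIntegrable
  rw [radialProfile, radialProfile, ← sub_eq_zero,
    intervalIntegral.integral_interval_sub_left (hi _ _) (hi _ _)]
  refine (intervalIntegral.integral_congr (g := fun _ => 0) fun t ht => ?_).trans (by simp)
  rw [uIcc_of_ge hs] at ht
  exact truncatedInvPow_eq_zero m hr ht.2

variable {E : Type*} [NormedAddCommGroup E]

/-- The radial function about `c` with value `radialResistance m r ‖x - c‖` where `r ≤ ‖x - c‖`,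
smoothed near `c`. For `m = dim E - 1` it is harmonic outside the ball of radius `r` and vanishes on
its boundary. -/
def radialPotential (m : ℕ) (r : ℝ) (c x : E) : ℝ :=
  radialProfile m r ‖x - c‖

theorem radialPotential_eq_radialResistance (hr : 0 < r) {c x : E} (hx : r ≤ ‖x - c‖) :
    radialPotential m r c x = radialResistance m r ‖x - c‖ :=
  radialProfile_eq_radialResistance m hr (by linarith)

variable [InnerProductSpace ℝ E]

theorem contDiff_radialPotential (hr : 0 < r) (c : E) :
    ContDiff ℝ ∞ (radialPotential m r c) := by
  refine contDiff_iff_contDiffAt.2 fun x => ?_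
  rcases eq_or_ne x c with rfl | hx
  · have hconst : radialPotential m r x =ᶠ[𝓝 x] fun _ => radialProfile m r (r / 4) := by
      filter_upwards [ball_mem_nhds x (show (0 : ℝ) < r / 4 by positivity)] with y hy
      exact radialProfile_eq_of_le m hr (mem_ball_iff_norm.1 hy).le
    exact contDiffAt_const.congr_of_eventuallyEq hconst
  · exact (contDiff_radialProfile m hr).contDiffAt.comp x
      ((contDiffAt_id.sub contDiffAt_const).norm ℝ (sub_ne_zero.2 hx))

theorem hasFDerivAt_norm_sub {c x : E} (hx : x ≠ c) :
    HasFDerivAt (fun y : E => ‖y - c‖) (‖x - c‖⁻¹ • innerSL ℝ (x - c)) x := by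
  have h0 : ‖x - c‖ ≠ 0 := norm_ne_zero_iff.2 (sub_ne_zero.2 hx)
  have hsqrt := (((hasFDerivAt_id x).sub_const c).norm_sq).sqrt (pow_ne_zero 2 h0)
  simp only [Real.sqrt_sq (norm_nonneg _), id] at hsqrt
  refine hsqrt.congr_fderiv ?_
  ext v
  simp
  field_simp

variable [CompleteSpace E]

theorem norm_gradient (φ : E → ℝ) (x : E) : ‖∇ φ x‖ = ‖fderiv ℝ φ x‖ :=
  (InnerProductSpace.toDual ℝ E).symm.norm_map _

theorem gradient_radialPotential (hr : 0 < r) {c x : E} (hx : r ≤ ‖x - c‖) :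
    ∇ (radialPotential m r c) x = (‖x - c‖ ^ (m + 1))⁻¹ • (x - c) := by
  have hxc : x ≠ c := sub_ne_zero.1 (norm_pos_iff.1 (hr.trans_le hx))
  have hd : HasFDerivAt (radialPotential m r c) _ x :=
    (hasDerivAt_radialProfile m hr ‖x - c‖).comp_hasFDerivAt x (hasFDerivAt_norm_sub hxc)
  refine ext_inner_right ℝ fun v => ?_
  rw [inner_gradient_left, hd.fderiv, truncatedInvPow_eq_inv_pow m hr (by linarith), pow_succ]
  simp only [_root_.smul_apply, innerSL_apply_apply, smul_eq_mul, inner_smul_left,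
    conj_trivial, mul_inv, mul_assoc]

theorem norm_gradient_radialPotential (hr : 0 < r) {c x : E} (hx : r ≤ ‖x - c‖) :
    ‖∇ (radialPotential m r c) x‖ = (‖x - c‖ ^ m)⁻¹ := by
  have h0 : ‖x - c‖ ≠ 0 := (hr.trans_le hx).ne'
  rw [gradient_radialPotential m hr hx, norm_smul, norm_inv, norm_pow, norm_norm, pow_succ]
  field_simp

theorem integral_ray_inner_gradient_radialPotential (hr : 0 < r) (c : E) {ψ : E → ℝ}
    (hψ : ContDiff ℝ 1 ψ) (w : sphere (0 : E) 1) {α β : ℝ} (hα : r ≤ α) (hαβ : α ≤ β) :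
    ∫ s in Ioo α β, s ^ m * inner ℝ (∇ (radialPotential m r c) (c + s • (w : E)))
        (∇ ψ (c + s • (w : E))) = ψ (c + β • (w : E)) - ψ (c + α • (w : E)) := by
  have hderiv : ∀ s : ℝ, HasDerivAt (fun s : ℝ => ψ (c + s • (w : E)))
      (fderiv ℝ ψ (c + s • (w : E)) w) s := fun s => by
    have hline : HasDerivAt (fun s : ℝ => c + s • (w : E)) w s := by
      simpa using ((hasDerivAt_id s).smul_const (w : E)).const_add c
    exact (hψ.differentiable one_ne_zero _).hasFDerivAt.comp_hasDerivAt s hline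
  have hcont : Continuous fun s : ℝ => fderiv ℝ ψ (c + s • (w : E)) w :=
    ((hψ.continuous_fderiv one_ne_zero).comp (by fun_prop)).clm_apply continuous_const
  rw [← intervalIntegral.integral_eq_sub_of_hasDerivAt (fun s _ => hderiv s)
    (hcont.intervalIntegrable α β), intervalIntegral.integral_of_le hαβ,
    integral_Ioc_eq_integral_Ioo]
  refine setIntegral_congr_fun measurableSet_Ioo fun s hs => ?_
  have hs0 : 0 < s := (hr.trans_le hα).trans hs.1
  have hnorm : ‖c + s • (w : E) - c‖ = s := by simp [norm_smul, hs0.le]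
  rw [gradient_radialPotential m hr (by rw [hnorm]; exact hα.trans hs.1.le), hnorm,
    add_sub_cancel_left, inner_smul_left, inner_smul_left, inner_gradient_right, pow_succ]
  simp only [conj_trivial]
  field_simp

end RadialPotential

section SphericalMean

theorem abs_radialResistance_sub_le {m : ℕ} (hm : m ≠ 0) {r a s t : ℝ} (hr : 0 < r) (ha : 1 ≤ a)
    (hs : a ≤ s) (ht : a ≤ t) :
    |radialResistance m r s - radialResistance m r t| ≤ a⁻¹ * |s - t| := by
  have ha0 : 0 < a := one_pos.trans_le ha
  rw [radialResistance, radialResistance, intervalIntegral.integral_interval_sub_left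
    (intervalIntegrable_inv_pow m hr (ha0.trans_le hs))
    (intervalIntegrable_inv_pow m hr (ha0.trans_le ht)), ← Real.norm_eq_abs]
  refine intervalIntegral.norm_integral_le_of_norm_le_const fun x hx => ?_
  have hax : a ≤ x := (le_min ht hs).trans hx.1.le
  have hx0 : 0 < x := ha0.trans_le hax
  rw [Real.norm_of_nonneg (by positivity)]
  exact inv_anti₀ ha0 (hax.trans (le_self_pow₀ (ha.trans hax) hm))

variable {n : ℕ}

theorem integrable_sphereMeasure {f : Euc n → ℝ} (hf : Continuous f) (c : Euc n) (ρ : ℝ) :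
    Integrable (fun w : sphere (0 : Euc n) 1 => f (c + ρ • (w : Euc n))) (sphereMeasure n) := by
  have hc : Continuous fun w : sphere (0 : Euc n) 1 => f (c + ρ • (w : Euc n)) := by fun_prop
  exact hc.integrable_of_hasCompactSupport (HasCompactSupport.of_compactSpace _)

theorem continuous_gradient {φ : Euc n → ℝ} (hφ : ContDiff ℝ 1 φ) : Continuous (∇ φ) :=
  (InnerProductSpace.toDual ℝ (Euc n)).symm.continuous.comp (hφ.continuous_fderiv one_ne_zero)

theorem norm_add_smul_sub_self (c : Euc n) {ρ : ℝ} (hρ : 0 ≤ ρ) (w : sphere (0 : Euc n) 1) :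
    ‖c + ρ • (w : Euc n) - c‖ = ρ := by
  simp [norm_smul, hρ]

theorem le_of_closedBall_subset_of_mem_sphere {r a : ℝ} {c₁ c₂ : Euc n}
    (h : closedBall c₂ r ⊆ ball c₁ a) {ρ : ℝ} (hρ : 0 ≤ ρ) {w : sphere (0 : Euc n) 1}
    (hw : c₂ + ρ • (w : Euc n) ∈ sphere c₁ a) : r ≤ ρ := by
  by_contra! hlt
  exact (h ((add_smul_mem_closedBall_iff c₂ hρ w).2 hlt.le)).ne hw

instance [NeZero n] : NeZero (sphereMeasure n) :=
  ⟨volume.toSphere_ne_zero⟩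

section Flux

variable [NeZero n] {r R a : ℝ} {c₁ c₂ : Euc n}

theorem setIntegral_inner_gradient_radialPotential (hr : 0 < r) (c : Euc n) {ψ : Euc n → ℝ}
    (hψ : ContDiff ℝ 1 ψ) {A : Set (Euc n)} (hA : MeasurableSet A) (hAb : Bornology.IsBounded A)
    {α β : sphere (0 : Euc n) 1 → ℝ} (hα : ∀ w, r ≤ α w) (hαβ : ∀ w, α w ≤ β w)
    (h : ∀ (w : sphere (0 : Euc n) 1) (s : ℝ), 0 < s →
      (c + s • (w : Euc n) ∈ A ↔ s ∈ Ioo (α w) (β w))) :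
    ∫ x in A, inner ℝ (∇ (radialPotential (n - 1) r c) x) (∇ ψ x) =
      ∫ w : sphere (0 : Euc n) 1, (ψ (c + β w • (w : Euc n)) - ψ (c + α w • (w : Euc n)))
        ∂(sphereMeasure n) := by
  have hcont : Continuous fun x => inner ℝ (∇ (radialPotential (n - 1) r c) x) (∇ ψ x) :=
    (continuous_gradient ((contDiff_radialPotential _ hr c).of_le (by simp))).inner
      (continuous_gradient hψ)
  have hint : IntegrableOn (fun x => inner ℝ (∇ (radialPotential (n - 1) r c) x) (∇ ψ x)) A :=
    (hcont.continuousOn.integrableOn_compact hAb.isCompact_closure).mono_set subset_closure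
  rw [setIntegral_polar volume c hA hint (fun w => hr.le.trans (hα w)) h,
    finrank_euclideanSpace_fin]
  exact integral_congr_ae (ae_of_all _ fun w =>
    integral_ray_inner_gradient_radialPotential (n - 1) hr c hψ w (hα w) (hαβ w))

/-- Green's identity for the potentials about the two centres: in polar coordinates about either
centre, `∫ ⟪∇Φ₁, ∇Φ₂⟫` over the shell between the spheres about `c₁` is a difference of boundary
values. -/
theorem integral_radialPotential_sub (hr : 0 < r) (hra : r ≤ a) (h : closedBall c₂ r ⊆ ball c₁ a)
    (haR : a ≤ R) :
    ∫ w : sphere (0 : Euc n) 1, (radialPotential (n - 1) r c₂ (c₁ + R • (w : Euc n)) -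
        radialPotential (n - 1) r c₂ (c₁ + a • (w : Euc n))) ∂(sphereMeasure n) =
      ∫ _w : sphere (0 : Euc n) 1, (radialResistance (n - 1) r R - radialResistance (n - 1) r a)
        ∂(sphereMeasure n) := by
  have hc : c₂ ∈ ball c₁ a := h (mem_closedBall_self hr.le)
  choose α hα hα_mem hα_exit using exists_ray_exit hc
  choose β _ hβ_mem hβ_exit using exists_ray_exit (ball_subset_ball haR hc)
  have hrα : ∀ w, r ≤ α w := fun w =>
    le_of_closedBall_subset_of_mem_sphere h (hα w).le (hα_mem w)
  have hαβ : ∀ w, α w ≤ β w := fun w =>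
    (hβ_exit w _ (hα w).le).2.1 (closedBall_subset_closedBall haR (hα_mem w).le)
  have hray : ∀ (w : sphere (0 : Euc n) 1) (s : ℝ), 0 < s →
      (c₂ + s • (w : Euc n) ∈ perforatedBall c₁ R c₁ a ↔ s ∈ Ioo (α w) (β w)) := fun w s hs => by
    rw [perforatedBall, Set.mem_sdiff, (hβ_exit w s hs.le).1, (hα_exit w s hs.le).2, not_le,
      and_comm, mem_Ioo]
  have hsmooth : ∀ c : Euc n, ContDiff ℝ 1 (radialPotential (n - 1) r c) := fun c =>
    (contDiff_radialPotential _ hr c).of_le (by simp)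
  have hsphere : ∀ {x : Euc n} {b : ℝ}, a ≤ b → x ∈ sphere c₁ b →
      radialPotential (n - 1) r c₁ x = radialResistance (n - 1) r b := fun {x b} hb hx => by
    have hnorm : ‖x - c₁‖ = b := mem_sphere_iff_norm.1 hx
    rw [radialPotential_eq_radialResistance _ hr (by linarith), hnorm]
  have hmeas := measurableSet_perforatedBall c₁ R c₁ a
  have hbdd : Bornology.IsBounded (perforatedBall c₁ R c₁ a) := isBounded_ball.subset sdiff_subset
  rw [← setIntegral_inner_gradient_radialPotential hr c₁ (hsmooth c₂) hmeas hbdd (fun _ => hra)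
    (fun _ => haR) fun w s hs => add_smul_mem_annulus_iff c₁ hs w]
  simp_rw [real_inner_comm (∇ (radialPotential (n - 1) r c₂) _)]
  rw [setIntegral_inner_gradient_radialPotential hr c₂ (hsmooth c₁) hmeas hbdd hrα hαβ hray]
  exact integral_congr_ae (ae_of_all _ fun w => by
    simp only [hsphere haR (hβ_mem w), hsphere le_rfl (hα_mem w)])

end Flux

theorem tendsto_integral_radialPotential_sub_radialResistance (hn : 2 ≤ n) {r : ℝ} (hr : 0 < r)
    (c₁ c₂ : Euc n) :
    Tendsto (fun t : ℝ => ∫ w : sphere (0 : Euc n) 1,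
      (radialPotential (n - 1) r c₂ (c₁ + t • (w : Euc n)) - radialResistance (n - 1) r t)
        ∂(sphereMeasure n)) atTop (𝓝 0) := by
  set d := dist c₁ c₂
  have hd : 0 ≤ d := dist_nonneg
  refine squeeze_zero_norm' (a := fun t : ℝ => (t - d)⁻¹ * d * (sphereMeasure n).real univ) ?_ ?_
  · filter_upwards [eventually_ge_atTop (d + r + 1)] with t ht
    refine norm_integral_le_of_norm_le_const (ae_of_all _ fun w => ?_)
    have hclose : |‖c₁ + t • (w : Euc n) - c₂‖ - t| ≤ d := by
      have := abs_norm_sub_norm_le (c₁ + t • (w : Euc n) - c₂) (c₁ + t • (w : Euc n) - c₁)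
      rwa [norm_add_smul_sub_self c₁ (by linarith) w, sub_sub_sub_cancel_left, ← dist_eq_norm]
        at this
    have hge := (abs_le.1 hclose).1
    rw [radialPotential_eq_radialResistance _ hr (by linarith), Real.norm_eq_abs]
    refine (abs_radialResistance_sub_le (by omega) hr (a := t - d) (by linarith) (by linarith)
      (by linarith)).trans (mul_le_mul_of_nonneg_left hclose (inv_nonneg.2 (by linarith)))
  · simpa [sub_eq_add_neg] using ((tendsto_inv_atTop_zero.comp
      (tendsto_atTop_add_const_right _ (-d) tendsto_id)).mul_const d).mul_const
        ((sphereMeasure n).real univ)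

variable {r R : ℝ} {c₁ c₂ : Euc n}

theorem average_radialPotential (hn : 2 ≤ n) (hr : 0 < r) (hrR : r < R)
    (h : closedBall c₂ r ⊆ ball c₁ R) :
    ⨍ w : sphere (0 : Euc n) 1, radialPotential (n - 1) r c₂ (c₁ + R • (w : Euc n))
        ∂(sphereMeasure n) = radialResistance (n - 1) r R := by
  have : NeZero n := ⟨by omega⟩
  have hcont : Continuous (radialPotential (n - 1) r c₂) :=
    (contDiff_radialPotential _ hr c₂).continuous
  have hzero : ∫ w : sphere (0 : Euc n) 1,
      (radialPotential (n - 1) r c₂ (c₁ + R • (w : Euc n)) - radialResistance (n - 1) r R)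
        ∂(sphereMeasure n) = 0 := by
    refine tendsto_nhds_unique (tendsto_const_nhds.congr' ?_)
      (tendsto_integral_radialPotential_sub_radialResistance hn hr c₁ c₂)
    filter_upwards [eventually_ge_atTop R] with t ht
    have := integral_radialPotential_sub hr hrR.le h ht
    have hint := fun ρ => integrable_sphereMeasure hcont c₁ ρ
    rw [integral_sub (hint _) (hint _), integral_sub (integrable_const _) (integrable_const _)]
      at this
    rw [integral_sub (hint _) (integrable_const _), integral_sub (hint _) (integrable_const _)]
    linarith
  rw [integral_sub (integrable_sphereMeasure hcont c₁ R) (integrable_const _), sub_eq_zero] at hzero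
  rw [average_eq, hzero, ← average_eq, average_const]

theorem le_average_radialPotential_sq (hn : 2 ≤ n) (hr : 0 < r) (hrR : r < R)
    (h : closedBall c₂ r ⊆ ball c₁ R) :
    radialResistance (n - 1) r R ^ 2 ≤
      ⨍ w : sphere (0 : Euc n) 1, radialPotential (n - 1) r c₂ (c₁ + R • (w : Euc n)) ^ 2
        ∂(sphereMeasure n) := by
  have : NeZero n := ⟨by omega⟩
  have hcont : Continuous (radialPotential (n - 1) r c₂) :=
    (contDiff_radialPotential _ hr c₂).continuous
  rw [← average_radialPotential hn hr hrR h]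
  exact (even_two.convexOn_pow (𝕜 := ℝ)).map_average_le (by fun_prop) isClosed_univ
    (by simp) (integrable_sphereMeasure hcont c₁ R) (integrable_sphereMeasure (hcont.pow 2) c₁ R)

end SphericalMean

section Rearrangement

variable {α : Type*} [MeasurableSpace α] {μ : Measure α} {A B : Set α} {f : α → ℝ≥0∞} {t : ℝ≥0∞}

theorem setLIntegral_sdiff_le_setLIntegral_sdiff (hA : MeasurableSet A) (hB : MeasurableSet B)
    (hμ : μ A = μ B) (hfin : μ A ≠ ⊤) (hle : ∀ x ∈ A \ B, f x ≤ t) (hge : ∀ x ∈ B \ A, t ≤ f x) :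
    ∫⁻ x in A \ B, f x ∂μ ≤ t * μ (A \ B) ∧ t * μ (A \ B) ≤ ∫⁻ x in B \ A, f x ∂μ := by
  have hsymm : μ (A \ B) = μ (B \ A) :=
    measure_sdiff_symm hA.nullMeasurableSet hB.nullMeasurableSet hμ
      (ne_top_of_le_ne_top hfin (measure_mono inter_subset_left))
  constructor
  · rw [← setLIntegral_const]
    exact setLIntegral_mono' (hA.diff hB) hle
  · rw [hsymm, ← setLIntegral_const]
    exact setLIntegral_mono' (hB.diff hA) hge

theorem setLIntegral_le_of_measure_eq (hA : MeasurableSet A) (hB : MeasurableSet B)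
    (hμ : μ A = μ B) (hfin : μ A ≠ ⊤) (hle : ∀ x ∈ A \ B, f x ≤ t) (hge : ∀ x ∈ B \ A, t ≤ f x) :
    ∫⁻ x in A, f x ∂μ ≤ ∫⁻ x in B, f x ∂μ := by
  obtain ⟨hAt, htB⟩ := setLIntegral_sdiff_le_setLIntegral_sdiff hA hB hμ hfin hle hge
  rw [← lintegral_inter_add_sdiff f A hB, ← lintegral_inter_add_sdiff f B hA, inter_comm B]
  exact add_le_add_right (hAt.trans htB) _

theorem setLIntegral_lt_of_measure_eq (hA : MeasurableSet A) (hB : MeasurableSet B)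
    (hμ : μ A = μ B) (hfin : μ A ≠ ⊤) (hle : ∀ x ∈ A \ B, f x ≤ t) (hge : ∀ x ∈ B \ A, t ≤ f x)
    {S : Set α} (hS : S ⊆ A \ B) (hS0 : μ S ≠ 0) (hlt : ∀ x ∈ S, f x < t)
    (hfi : ∫⁻ x in B, f x ∂μ ≠ ⊤) :
    ∫⁻ x in A, f x ∂μ < ∫⁻ x in B, f x ∂μ := by
  obtain ⟨hAt, htB⟩ := setLIntegral_sdiff_le_setLIntegral_sdiff hA hB hμ hfin hle hge
  have hne : ∀ {s : Set α}, s ⊆ B → ∫⁻ x in s, f x ∂μ ≠ ⊤ := fun hs =>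
    ne_top_of_le_ne_top hfi (lintegral_mono_set hs)
  have hstrict : ∫⁻ x in A \ B, f x ∂μ < t * μ (A \ B) := by
    rw [← setLIntegral_const]
    refine lintegral_strict_mono_of_ae_le_of_frequently_ae_lt aemeasurable_const
      (ne_top_of_le_ne_top (hne sdiff_subset) (hAt.trans htB))
      (ae_restrict_of_forall_mem (hA.diff hB) hle) ?_
    rw [frequently_ae_iff, Measure.restrict_apply₀' (hA.diff hB).nullMeasurableSet]
    exact fun h0 => hS0 (measure_mono_null (fun x hx => And.intro (hlt x hx).ne (hS hx)) h0)
  rw [← lintegral_inter_add_sdiff f A hB, ← lintegral_inter_add_sdiff f B hA, inter_comm B]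
  exact ENNReal.add_lt_add_left (hne inter_subset_right) (hstrict.trans_le htB)

end Rearrangement

section DirichletIntegral

variable {n : ℕ} {r R : ℝ} {c₁ c₂ : Euc n}

theorem volume_perforatedBall_ne_top (c₁ : Euc n) (R : ℝ) (c₂ : Euc n) (r : ℝ) :
    volume (perforatedBall c₁ R c₂ r) ≠ ⊤ :=
  (isBounded_ball.subset sdiff_subset).measure_lt_top.ne

theorem volume_perforatedBall_eq (h : closedBall c₂ r ⊆ ball c₁ R) (hrR : r < R) :
    volume (perforatedBall c₁ R c₂ r) = volume (perforatedBall c₂ R c₂ r) := by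
  have hmeas := (measurableSet_closedBall (x := c₂) (ε := r)).nullMeasurableSet (μ := volume)
  rw [perforatedBall, perforatedBall, measure_sdiff h hmeas measure_closedBall_lt_top.ne,
    measure_sdiff (closedBall_subset_ball hrR) hmeas measure_closedBall_lt_top.ne,
    Measure.addHaar_ball_center, Measure.addHaar_ball_center volume c₂]

theorem volume_ball_sdiff_closedBall_ne_zero (hne : c₁ ≠ c₂) (hc : c₂ ∈ ball c₁ R) :
    volume (ball c₁ R \ closedBall c₂ R) ≠ 0 := by
  have hd : 0 < dist c₂ c₁ := dist_pos.2 hne.symm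
  have hdR : dist c₂ c₁ < R := hc
  refine ((isOpen_ball.sdiff isClosed_closedBall).measure_pos volume
    ⟨AffineMap.lineMap c₂ c₁ (R / dist c₂ c₁ + 1 / 2), ?_, ?_⟩).ne'
  · rw [mem_ball, dist_lineMap_right, ← Real.norm_of_nonneg hd.le, ← norm_mul, Real.norm_of_nonneg
      hd.le, sub_mul, add_mul, one_mul, div_mul_cancel₀ _ hd.ne', Real.norm_eq_abs, abs_lt]
    constructor <;> linarith
  · have hR : 0 < R := hd.trans hdR
    rw [mem_closedBall, dist_lineMap_left, Real.norm_of_nonneg (by positivity), add_mul,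
      div_mul_cancel₀ _ hd.ne']
    linarith

theorem enorm_gradient_radialPotential (m : ℕ) (hr : 0 < r) (c : Euc n) {x : Euc n}
    (hx : r ≤ ‖x - c‖) :
    ‖∇ (radialPotential m r c) x‖ₑ ^ 2 = ENNReal.ofReal ((‖x - c‖ ^ m)⁻¹) ^ 2 := by
  rw [← ofReal_norm, norm_gradient_radialPotential m hr hx]

theorem lintegral_gradient_radialPotential [NeZero n] (hr : 0 < r) (hrR : r ≤ R) (c : Euc n) :
    ∫⁻ x in perforatedBall c R c r, ‖∇ (radialPotential (n - 1) r c) x‖ₑ ^ 2 =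
      ENNReal.ofReal (radialResistance (n - 1) r R) * sphereMeasure n univ := by
  have hcont := continuous_gradient ((contDiff_radialPotential (n - 1) hr c).of_le
    (by simp))
  rw [perforatedBall, setLIntegral_annulus volume c hr.le R (by fun_prop),
    finrank_euclideanSpace_fin, ofReal_radialResistance _ hr hrR, ← lintegral_const]
  refine lintegral_congr fun w => setLIntegral_congr_fun measurableSet_Ioo fun s hs => ?_
  have hs0 : 0 < s ^ (n - 1) := pow_pos (hr.trans hs.1) _
  have hnorm := norm_add_smul_sub_self c (hr.trans hs.1).le w
  simp only [enorm_gradient_radialPotential (n - 1) hr c (hnorm.symm ▸ hs.1.le), hnorm]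
  rw [ENNReal.ofReal_inv_of_pos hs0, sq, ENNReal.mul_inv_cancel_left
    (ENNReal.ofReal_pos.2 hs0).ne' ENNReal.ofReal_ne_top]

theorem le_enorm_gradient_radialPotential_sq (m : ℕ) (hr : 0 < r) {x : Euc n}
    (hx : x ∈ perforatedBall c₂ R c₂ r) :
    ENNReal.ofReal ((R ^ m)⁻¹) ^ 2 ≤ ‖∇ (radialPotential m r c₂) x‖ₑ ^ 2 := by
  have hrx : r < ‖x - c₂‖ := by simpa [dist_eq_norm] using hx.2
  have hxR : ‖x - c₂‖ < R := mem_ball_iff_norm.1 hx.1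
  have hx0 : 0 < ‖x - c₂‖ := hr.trans hrx
  rw [enorm_gradient_radialPotential m hr c₂ hrx.le]
  gcongr

theorem enorm_gradient_radialPotential_sq_le (m : ℕ) (hr : 0 < r) (hrR : r ≤ R) {x : Euc n}
    (hx : x ∈ perforatedBall c₁ R c₂ r \ perforatedBall c₂ R c₂ r) :
    ‖∇ (radialPotential m r c₂) x‖ₑ ^ 2 ≤ ENNReal.ofReal ((R ^ m)⁻¹) ^ 2 := by
  have hR : 0 < R := hr.trans_le hrR
  have hRx : R ≤ ‖x - c₂‖ :=
    not_lt.1 fun hlt => hx.2 ⟨mem_ball_iff_norm.2 hlt, hx.1.2⟩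
  rw [enorm_gradient_radialPotential m hr c₂ (hrR.trans hRx)]
  gcongr

theorem enorm_gradient_radialPotential_sq_lt {m : ℕ} (hm : m ≠ 0) (hr : 0 < r) (hrR : r ≤ R)
    {x : Euc n} (hx : x ∉ closedBall c₂ R) :
    ‖∇ (radialPotential m r c₂) x‖ₑ ^ 2 < ENNReal.ofReal ((R ^ m)⁻¹) ^ 2 := by
  have hR : 0 < R := hr.trans_le hrR
  have hRx : R < ‖x - c₂‖ := by simpa [dist_eq_norm] using hx
  rw [enorm_gradient_radialPotential m hr c₂ (hrR.trans hRx.le)]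
  refine ENNReal.pow_lt_pow_left two_ne_zero
    ((ENNReal.ofReal_lt_ofReal_iff (by positivity)).2 ?_)
  gcongr

theorem lintegral_gradient_radialPotential_le [NeZero n] (hr : 0 < r) (hrR : r < R)
    (h : closedBall c₂ r ⊆ ball c₁ R) :
    ∫⁻ x in perforatedBall c₁ R c₂ r, ‖∇ (radialPotential (n - 1) r c₂) x‖ₑ ^ 2 ≤
      ENNReal.ofReal (radialResistance (n - 1) r R) * sphereMeasure n univ := by
  rw [← lintegral_gradient_radialPotential hr hrR.le c₂]
  exact setLIntegral_le_of_measure_eq (measurableSet_perforatedBall c₁ R c₂ r)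
    (measurableSet_perforatedBall c₂ R c₂ r) (volume_perforatedBall_eq h hrR)
    (volume_perforatedBall_ne_top c₁ R c₂ r)
    (fun _ => enorm_gradient_radialPotential_sq_le _ hr hrR.le)
    fun _ hx => le_enorm_gradient_radialPotential_sq _ hr hx.1

theorem lintegral_gradient_radialPotential_lt (hn : 2 ≤ n) (hr : 0 < r) (hrR : r < R)
    (h : closedBall c₂ r ⊆ ball c₁ R) (hne : c₁ ≠ c₂) :
    ∫⁻ x in perforatedBall c₁ R c₂ r, ‖∇ (radialPotential (n - 1) r c₂) x‖ₑ ^ 2 <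
      ENNReal.ofReal (radialResistance (n - 1) r R) * sphereMeasure n univ := by
  have : NeZero n := ⟨by omega⟩
  have hfin : ∫⁻ x in perforatedBall c₂ R c₂ r, ‖∇ (radialPotential (n - 1) r c₂) x‖ₑ ^ 2 ≠ ⊤ := by
    rw [lintegral_gradient_radialPotential hr hrR.le c₂]
    finiteness
  rw [← lintegral_gradient_radialPotential hr hrR.le c₂]
  refine setLIntegral_lt_of_measure_eq (S := ball c₁ R \ closedBall c₂ R)
    (measurableSet_perforatedBall c₁ R c₂ r)
    (measurableSet_perforatedBall c₂ R c₂ r) (volume_perforatedBall_eq h hrR)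
    (volume_perforatedBall_ne_top c₁ R c₂ r)
    (fun _ => enorm_gradient_radialPotential_sq_le _ hr hrR.le)
    (fun _ hx => le_enorm_gradient_radialPotential_sq _ hr hx.1) (fun x hx => ⟨?_, ?_⟩)
    (volume_ball_sdiff_closedBall_ne_zero hne (h (mem_closedBall_self hr.le)))
    (fun _ hx => enorm_gradient_radialPotential_sq_lt (by omega) hr hrR.le hx.2) hfin
  · exact ⟨hx.1, fun hxr => hx.2 (closedBall_subset_closedBall hrR.le hxr)⟩
  · exact fun hxB => hx.2 (ball_subset_closedBall hxB.1)

end DirichletIntegral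

section Gradient

variable {n : ℕ} {φ ψ : Euc n → ℝ} {x : Euc n}

theorem gradient_add (hφ : DifferentiableAt ℝ φ x) (hψ : DifferentiableAt ℝ ψ x) :
    ∇ (φ + ψ) x = ∇ φ x + ∇ ψ x := by
  simp only [gradient, fderiv_add hφ hψ, map_add]

theorem gradient_const_smul (a : ℝ) : ∇ (a • φ) x = a • ∇ φ x := by
  simp [gradient, fderiv_const_smul_field]

theorem gradient_mul (hφ : DifferentiableAt ℝ φ x) (hψ : DifferentiableAt ℝ ψ x) :
    ∇ (φ * ψ) x = φ x • ∇ ψ x + ψ x • ∇ φ x := by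
  simp [gradient, fderiv_mul hφ hψ]

theorem integral_mul_fderiv_eq_neg_integral_inner_gradient (hφ : ContDiff ℝ 1 φ)
    (hψ : ContDiff ℝ 1 ψ) (hc : HasCompactSupport ψ) (v : Euc n) :
    ∫ x, φ x * fderiv ℝ ψ x v = - ∫ x, inner ℝ (∇ φ x) v * ψ x := by
  have hφ' : Continuous fun x => fderiv ℝ φ x v :=
    (hφ.continuous_fderiv one_ne_zero).clm_apply continuous_const
  have hψ' : Continuous fun x => fderiv ℝ ψ x v :=
    (hψ.continuous_fderiv one_ne_zero).clm_apply continuous_const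
  simp only [inner_gradient_left]
  refine integral_mul_fderiv_eq_neg_fderiv_mul_of_integrable
    ((hφ'.mul hψ.continuous).integrable_of_hasCompactSupport hc.mul_left)
    ((hφ.continuous.mul hψ').integrable_of_hasCompactSupport (hc.fderiv_apply ℝ v).mul_left)
    ((hφ.continuous.mul hψ.continuous).integrable_of_hasCompactSupport hc.mul_left)
    (fun x _ => hφ.differentiable one_ne_zero x) (fun x _ => hψ.differentiable one_ne_zero x)

theorem setIntegral_mul_fderiv_eq_neg_setIntegral_inner_gradient (hφ : ContDiff ℝ 1 φ)
    (hψ : ContDiff ℝ 1 ψ) (hc : HasCompactSupport ψ) {Ω : Set (Euc n)} (hs : tsupport ψ ⊆ Ω)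
    (v : Euc n) : ∫ x in Ω, φ x * fderiv ℝ ψ x v = - ∫ x in Ω, inner ℝ (∇ φ x) v * ψ x := by
  have hψ0 (x : Euc n) (hx : x ∉ Ω) : ψ x = 0 :=
    image_eq_zero_of_notMem_tsupport fun h => hx (hs h)
  have hψ'0 (x : Euc n) (hx : x ∉ Ω) : fderiv ℝ ψ x = 0 :=
    image_eq_zero_of_notMem_tsupport fun h => hx (hs (tsupport_fderiv_subset ℝ h))
  rw [setIntegral_eq_integral_of_forall_compl_eq_zero fun x hx => by simp [hψ'0 x hx],
    setIntegral_eq_integral_of_forall_compl_eq_zero fun x hx => by simp [hψ0 x hx]]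
  exact integral_mul_fderiv_eq_neg_integral_inner_gradient hφ hψ hc v

end Gradient

section TraceSpace

variable {n : ℕ}

theorem exists_ae_norm_le_of_continuous {F : Type*} [NormedAddCommGroup F] {f : Euc n → F}
    (hf : Continuous f) (c₁ : Euc n) (R : ℝ) (c₂ : Euc n) (r : ℝ) :
    ∃ M, ∀ᵐ x ∂(volume.restrict (perforatedBall c₁ R c₂ r)), ‖f x‖ ≤ M := by
  obtain ⟨M, hM⟩ := (isCompact_closedBall c₁ R).exists_bound_of_continuousOn hf.continuousOn
  refine ⟨M, ?_⟩
  filter_upwards [ae_restrict_mem (measurableSet_perforatedBall c₁ R c₂ r)] with x hx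
  exact hM x (ball_subset_closedBall hx.1)

theorem memLp_perforatedBall_of_continuous {F : Type*} [NormedAddCommGroup F] {p : ℝ≥0∞}
    {f : Euc n → F} (hf : Continuous f) (c₁ : Euc n) (R : ℝ) (c₂ : Euc n) (r : ℝ) :
    MemLp f p (volume.restrict (perforatedBall c₁ R c₂ r)) := by
  have : IsFiniteMeasure (volume.restrict (perforatedBall c₁ R c₂ r)) :=
    isFiniteMeasure_restrict.2 (volume_perforatedBall_ne_top c₁ R c₂ r)
  obtain ⟨M, hM⟩ := exists_ae_norm_le_of_continuous hf c₁ R c₂ r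
  exact .of_bound hf.aestronglyMeasurable M hM

theorem memLp_surfaceMeasure_of_continuous {F : Type*} [NormedAddCommGroup F] {p : ℝ≥0∞}
    {f : Euc n → F} (hf : Continuous f) (c : Euc n) (ρ : ℝ) : MemLp f p (surfaceMeasure c ρ) := by
  have hg : Continuous fun y : sphere (0 : Euc n) 1 => c + ρ • (y : Euc n) := by fun_prop
  refine MemLp.smul_measure ?_ ENNReal.ofReal_ne_top
  refine (memLp_map_measure_iff hf.aestronglyMeasurable hg.aemeasurable).2 ?_
  exact (hf.comp hg).memLp_of_hasCompactSupport (.of_compactSpace _)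

variable (c₁ : Euc n) (R : ℝ) (c₂ : Euc n) (r : ℝ)

/-- The Banach space of triples consisting of a function on the domain, a vector field on it (its
gradient) and a function on the outer sphere (its trace). The norm is the maximum of the three
`L²` norms. -/
abbrev TraceTriple : Type :=
  Lp ℝ 2 (volume.restrict (perforatedBall c₁ R c₂ r)) ×
    Lp (Euc n) 2 (volume.restrict (perforatedBall c₁ R c₂ r)) × Lp ℝ 2 (surfaceMeasure c₁ R)

/-- The vector space of smooth real functions on `ℝⁿ`. -/
def smoothFunctions (n : ℕ) : Submodule ℝ (Euc n → ℝ) where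
  carrier := {φ | ContDiff ℝ ∞ φ}
  add_mem' {φ ψ} (hφ : ContDiff ℝ ∞ φ) (hψ : ContDiff ℝ ∞ ψ) := hφ.add hψ
  zero_mem' := (contDiff_const : ContDiff ℝ ∞ fun _ => (0 : ℝ))
  smul_mem' a φ (hφ : ContDiff ℝ ∞ φ) := hφ.const_smul a

theorem contDiff_coe (φ : smoothFunctions n) : ContDiff ℝ ∞ (φ : Euc n → ℝ) :=
  φ.property

theorem contDiff_one_coe (φ : smoothFunctions n) : ContDiff ℝ 1 (φ : Euc n → ℝ) :=
  (contDiff_coe φ).of_le (by simp)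

theorem memLp_coe (φ : smoothFunctions n) (c₁ : Euc n) (R : ℝ) (c₂ : Euc n)
    (r : ℝ) : MemLp (φ : Euc n → ℝ) 2 (volume.restrict (perforatedBall c₁ R c₂ r)) :=
  memLp_perforatedBall_of_continuous (contDiff_coe φ).continuous c₁ R c₂ r

theorem memLp_gradient_coe (φ : smoothFunctions n) (c₁ : Euc n) (R : ℝ) (c₂ : Euc n)
    (r : ℝ) : MemLp (∇ (φ : Euc n → ℝ)) 2 (volume.restrict (perforatedBall c₁ R c₂ r)) :=
  memLp_perforatedBall_of_continuous (continuous_gradient (contDiff_one_coe φ)) c₁ R c₂ r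

theorem memLp_trace_coe (φ : smoothFunctions n) (c : Euc n) (ρ : ℝ) :
    MemLp (φ : Euc n → ℝ) 2 (surfaceMeasure c ρ) :=
  memLp_surfaceMeasure_of_continuous (contDiff_coe φ).continuous c ρ

/-- A smooth function, its gradient, and its restrictions to the outer and the inner sphere, as
elements of the respective `L²` spaces. -/
def smoothData :
    smoothFunctions n →ₗ[ℝ] TraceTriple c₁ R c₂ r × Lp ℝ 2 (surfaceMeasure c₂ r) where
  toFun φ :=
    (((memLp_coe φ c₁ R c₂ r).toLp φ.1, (memLp_gradient_coe φ c₁ R c₂ r).toLp (∇ (φ : Euc n → ℝ)),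
      (memLp_trace_coe φ c₁ R).toLp φ.1), (memLp_trace_coe φ c₂ r).toLp φ.1)
  map_add' φ ψ := by
    have hgrad : ∇ ((φ + ψ : smoothFunctions n) : Euc n → ℝ) = ∇ (φ : Euc n → ℝ) + ∇ ψ.1 :=
      funext fun x => gradient_add ((contDiff_one_coe φ).differentiable one_ne_zero x)
        ((contDiff_one_coe ψ).differentiable one_ne_zero x)
    simp only [hgrad]
    rfl
  map_smul' a φ := by
    have hgrad : ∇ ((a • φ : smoothFunctions n) : Euc n → ℝ) = a • ∇ (φ : Euc n → ℝ) :=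
      funext fun x => gradient_const_smul a
    simp only [hgrad]
    rfl

/-- The triples (function, gradient, outer trace) of the `H¹` functions whose trace on the inner
sphere vanishes: the limits of smooth functions for which all four components of `smoothData`
converge, the last one to `0`. -/
def admissibleSpace : Submodule ℝ (TraceTriple c₁ R c₂ r) :=
  (LinearMap.range (smoothData c₁ R c₂ r)).topologicalClosure.comap (LinearMap.inl ℝ _ _)

variable {c₁ R c₂ r}

theorem isClosed_admissibleSpace :
    IsClosed (admissibleSpace c₁ R c₂ r : Set (TraceTriple c₁ R c₂ r)) :=
  (Submodule.isClosed_topologicalClosure _).preimage (ContinuousLinearMap.inl ℝ _ _).continuous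

instance : CompleteSpace (admissibleSpace c₁ R c₂ r) :=
  isClosed_admissibleSpace.completeSpace_coe

theorem admissibleSpace_induction {P : Set (TraceTriple c₁ R c₂ r × Lp ℝ 2 (surfaceMeasure c₂ r))}
    (hP : IsClosed P) (hsmooth : ∀ φ, smoothData c₁ R c₂ r φ ∈ P) {x : TraceTriple c₁ R c₂ r}
    (hx : x ∈ admissibleSpace c₁ R c₂ r) : (x, 0) ∈ P :=
  closure_minimal (range_subset_iff.2 hsmooth) hP hx

theorem setIntegral_mul_fderiv_of_mem_admissibleSpace {x : TraceTriple c₁ R c₂ r}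
    (hx : x ∈ admissibleSpace c₁ R c₂ r) {ψ : Euc n → ℝ} (hψ : ContDiff ℝ 1 ψ)
    (hc : HasCompactSupport ψ) (hs : tsupport ψ ⊆ perforatedBall c₁ R c₂ r) (v : Euc n) :
    ∫ z in perforatedBall c₁ R c₂ r, x.1 z * fderiv ℝ ψ z v =
      - ∫ z in perforatedBall c₁ R c₂ r, inner ℝ (x.2.1 z) v * ψ z := by
  have m₁ : MemLp (fun z => fderiv ℝ ψ z v) 2 (volume.restrict (perforatedBall c₁ R c₂ r)) :=
    memLp_perforatedBall_of_continuous
      ((hψ.continuous_fderiv one_ne_zero).clm_apply continuous_const) c₁ R c₂ r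
  have m₂ : MemLp (fun z => ψ z • v) 2 (volume.restrict (perforatedBall c₁ R c₂ r)) :=
    memLp_perforatedBall_of_continuous (hψ.continuous.smul continuous_const) c₁ R c₂ r
  have e₁ (f : Lp ℝ 2 (volume.restrict (perforatedBall c₁ R c₂ r))) :
      inner ℝ (m₁.toLp _) f = ∫ z in perforatedBall c₁ R c₂ r, f z * fderiv ℝ ψ z v := by
    rw [L2.inner_def]
    refine integral_congr_ae ?_
    filter_upwards [m₁.coeFn_toLp] with z hz
    rw [hz, RCLike.inner_apply, conj_trivial]
  have e₂ (f : Lp (Euc n) 2 (volume.restrict (perforatedBall c₁ R c₂ r))) :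
      inner ℝ (m₂.toLp _) f = ∫ z in perforatedBall c₁ R c₂ r, inner ℝ (f z) v * ψ z := by
    rw [L2.inner_def]
    refine integral_congr_ae ?_
    filter_upwards [m₂.coeFn_toLp] with z hz
    rw [hz, real_inner_smul_left, real_inner_comm, mul_comm]
  rw [← e₁, ← e₂]
  refine admissibleSpace_induction
    (P := {y | inner ℝ (m₁.toLp _) y.1.1 = - inner ℝ (m₂.toLp _) y.1.2.1})
    (isClosed_eq (by fun_prop) (by fun_prop)) (fun φ => ?_) hx
  calc inner ℝ (m₁.toLp _) (smoothData c₁ R c₂ r φ).1.1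
      = ∫ z in perforatedBall c₁ R c₂ r, φ.1 z * fderiv ℝ ψ z v :=
        (e₁ _).trans (integral_congr_ae ((memLp_coe φ c₁ R c₂ r).coeFn_toLp.mul (ae_eq_refl _)))
    _ = - ∫ z in perforatedBall c₁ R c₂ r, inner ℝ (∇ φ.1 z) v * ψ z :=
        setIntegral_mul_fderiv_eq_neg_setIntegral_inner_gradient (contDiff_one_coe φ) hψ hc hs v
    _ = - inner ℝ (m₂.toLp _) (smoothData c₁ R c₂ r φ).1.2.1 := by
        rw [e₂]
        refine congrArg _ (integral_congr_ae ?_)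
        filter_upwards [(memLp_gradient_coe φ c₁ R c₂ r).coeFn_toLp] with z hz
        exact congrArg (inner ℝ · v * ψ z) hz.symm

theorem tendsto_eLpNorm_sub_of_tendsto_toLp {α F : Type*} [MeasurableSpace α] {μ : Measure α}
    [NormedAddCommGroup F] {f : ℕ → α → F} (hf : ∀ k, MemLp (f k) 2 μ) {g : Lp F 2 μ}
    (h : Tendsto (fun k => (hf k).toLp (f k)) atTop (𝓝 g)) :
    Tendsto (fun k => eLpNorm (fun x => f k x - g x) 2 μ) atTop (𝓝 0) := by
  refine ((Lp.tendsto_Lp_iff_tendsto_eLpNorm' _ g).1 h).congr fun k => eLpNorm_congr_ae ?_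
  filter_upwards [(hf k).coeFn_toLp] with x hx
  rw [Pi.sub_apply, hx]

theorem isAdmissible_of_mem_admissibleSpace {x : TraceTriple c₁ R c₂ r}
    (hx : x ∈ admissibleSpace c₁ R c₂ r) : IsAdmissible c₁ R c₂ r x.1 x.2.1 x.2.2 := by
  obtain ⟨y, hy, hlim⟩ := mem_closure_iff_seq_limit.1 hx
  choose φ hφ using hy
  obtain rfl : (fun k => smoothData c₁ R c₂ r (φ k)) = y := funext hφ
  have t₁ := tendsto_eLpNorm_sub_of_tendsto_toLp (fun k => memLp_coe (φ k) _ _ _ _)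
    ((continuous_fst.fst.tendsto _).comp hlim)
  have t₂ := tendsto_eLpNorm_sub_of_tendsto_toLp (fun k => memLp_gradient_coe (φ k) _ _ _ _)
    ((continuous_fst.snd.fst.tendsto _).comp hlim)
  have t₃ := tendsto_eLpNorm_sub_of_tendsto_toLp (fun k => memLp_trace_coe (φ k) _ _)
    ((continuous_fst.snd.snd.tendsto _).comp hlim)
  have t₄ := tendsto_eLpNorm_sub_of_tendsto_toLp (fun k => memLp_trace_coe (φ k) _ _)
    ((continuous_snd.tendsto _).comp hlim)
  refine ⟨⟨Lp.memLp _, Lp.memLp _, fun ψ hψ hc hs v =>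
      setIntegral_mul_fderiv_of_mem_admissibleSpace hx (hψ.of_le (by simp)) hc hs v⟩,
    ⟨Lp.memLp _, fun k => φ k, fun k => contDiff_coe (φ k), t₁, t₂, t₃⟩,
    ⟨MemLp.zero, fun k => φ k, fun k => contDiff_coe (φ k), t₁, t₂,
      t₄.congr fun k => eLpNorm_congr_ae ?_⟩⟩
  filter_upwards [Lp.coeFn_zero ℝ 2 (surfaceMeasure c₂ r)] with z hz
  exact congrArg ((φ k).1 z - ·) hz

end TraceSpace

section Cutoff

variable {n : ℕ} {c₁ c₂ : Euc n} {R r : ℝ}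

theorem exists_cutoff (h : closedBall c₂ r ⊆ ball c₁ R) :
    ∃ χ : Euc n → ℝ, ContDiff ℝ ∞ χ ∧ EqOn χ 1 (sphere c₁ R) ∧ EqOn χ 0 (sphere c₂ r) := by
  have hdisj : Disjoint (sphere c₂ r) (sphere c₁ R) :=
    sphere_disjoint_ball.symm.mono_left (sphere_subset_closedBall.trans h)
  obtain ⟨χ, hχ0, hχ1, -⟩ := exists_contMDiffMap_zero_one_of_isClosed (n := ⊤)
    (modelWithCornersSelf ℝ (Euc n)) isClosed_sphere isClosed_sphere hdisj
  exact ⟨χ, χ.contMDiff.contDiff, hχ1, hχ0⟩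

theorem tendsto_eLpNorm_zero_of_norm_le_mul {α F F' : Type*} [MeasurableSpace α] {μ : Measure α}
    [NormedAddCommGroup F] [NormedAddCommGroup F'] {p : ℝ≥0∞} {f : ℕ → α → F} {g : ℕ → α → F'}
    {M : ℝ} (hfg : ∀ k, ∀ᵐ x ∂μ, ‖f k x‖ ≤ M * ‖g k x‖)
    (hg : Tendsto (fun k => eLpNorm (g k) p μ) atTop (𝓝 0)) :
    Tendsto (fun k => eLpNorm (f k) p μ) atTop (𝓝 0) := by
  refine tendsto_of_tendsto_of_tendsto_of_le_of_le tendsto_const_nhds ?_ (fun _ => zero_le)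
    fun k => eLpNorm_le_mul_eLpNorm_of_ae_le_mul (hfg k) p
  simpa using ENNReal.Tendsto.const_mul hg (Or.inr ENNReal.ofReal_ne_top)

theorem tendsto_eLpNorm_add_zero {α F : Type*} [MeasurableSpace α] {μ : Measure α}
    [NormedAddCommGroup F] {f g : ℕ → α → F} (hf : ∀ k, AEStronglyMeasurable (f k) μ)
    (hg : ∀ k, AEStronglyMeasurable (g k) μ)
    (lf : Tendsto (fun k => eLpNorm (f k) 2 μ) atTop (𝓝 0))
    (lg : Tendsto (fun k => eLpNorm (g k) 2 μ) atTop (𝓝 0)) :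
    Tendsto (fun k => eLpNorm (f k + g k) 2 μ) atTop (𝓝 0) := by
  have l := lf.add lg
  rw [add_zero] at l
  exact tendsto_of_tendsto_of_tendsto_of_le_of_le tendsto_const_nhds l (fun _ => zero_le)
    fun k => eLpNorm_add_le (hf k) (hg k) one_le_two

theorem tendsto_eLpNorm_sub_zero {α F : Type*} [MeasurableSpace α] {μ : Measure α}
    [NormedAddCommGroup F] {f g : ℕ → α → F} {u : α → F}
    (hf : ∀ k, AEStronglyMeasurable (f k - u) μ) (hg : ∀ k, AEStronglyMeasurable (g k - u) μ)
    (lf : Tendsto (fun k => eLpNorm (f k - u) 2 μ) atTop (𝓝 0))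
    (lg : Tendsto (fun k => eLpNorm (g k - u) 2 μ) atTop (𝓝 0)) :
    Tendsto (fun k => eLpNorm (f k - g k) 2 μ) atTop (𝓝 0) := by
  have l := tendsto_eLpNorm_add_zero hf (fun k => (hg k).neg) lf (by simpa only [eLpNorm_neg])
  refine l.congr fun k => ?_
  rw [← sub_eq_add_neg, sub_sub_sub_cancel_right]

theorem tendsto_eLpNorm_gradient_mul_zero {μ : Measure (Euc n)} {χ : Euc n → ℝ}
    (hχ : ContDiff ℝ 1 χ) {M M' : ℝ} (hM : ∀ᵐ x ∂μ, ‖χ x‖ ≤ M) (hM' : ∀ᵐ x ∂μ, ‖∇ χ x‖ ≤ M')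
    {φ : ℕ → Euc n → ℝ} (hφ : ∀ k, ContDiff ℝ 1 (φ k))
    (l : Tendsto (fun k => eLpNorm (φ k) 2 μ) atTop (𝓝 0))
    (l' : Tendsto (fun k => eLpNorm (∇ (φ k)) 2 μ) atTop (𝓝 0)) :
    Tendsto (fun k => eLpNorm (∇ (χ * φ k)) 2 μ) atTop (𝓝 0) := by
  have hgrad (k : ℕ) : ∇ (χ * φ k) = χ • ∇ (φ k) + φ k • ∇ χ := funext fun x =>
    gradient_mul (hχ.differentiable one_ne_zero x) ((hφ k).differentiable one_ne_zero x)
  simp only [hgrad]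
  refine tendsto_eLpNorm_add_zero
    (fun k => (hχ.continuous.smul (continuous_gradient (hφ k))).aestronglyMeasurable)
    (fun k => ((hφ k).continuous.smul (continuous_gradient hχ)).aestronglyMeasurable)
    (tendsto_eLpNorm_zero_of_norm_le_mul (M := M) (fun k => ?_) l')
    (tendsto_eLpNorm_zero_of_norm_le_mul (M := M') (fun k => ?_) l)
  · filter_upwards [hM] with x hx
    rw [Pi.smul_apply', norm_smul]
    exact mul_le_mul_of_nonneg_right hx (norm_nonneg _)
  · filter_upwards [hM'] with x hx
    rw [Pi.smul_apply', norm_smul, mul_comm]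
    exact mul_le_mul_of_nonneg_right hx (norm_nonneg _)

theorem tendsto_eLpNorm_gluing {u : Euc n → ℝ} {G : Euc n → Euc n}
    (hu : AEStronglyMeasurable u (volume.restrict (perforatedBall c₁ R c₂ r)))
    (hG : AEStronglyMeasurable G (volume.restrict (perforatedBall c₁ R c₂ r)))
    {χ : Euc n → ℝ} (hχ : ContDiff ℝ 1 χ) {φ ψ : ℕ → Euc n → ℝ} (hφ : ∀ k, ContDiff ℝ 1 (φ k))
    (hψ : ∀ k, ContDiff ℝ 1 (ψ k))
    (φu : Tendsto (fun k => eLpNorm (φ k - u) 2 (volume.restrict (perforatedBall c₁ R c₂ r)))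
      atTop (𝓝 0))
    (φG : Tendsto (fun k => eLpNorm (∇ (φ k) - G) 2 (volume.restrict (perforatedBall c₁ R c₂ r)))
      atTop (𝓝 0))
    (ψu : Tendsto (fun k => eLpNorm (ψ k - u) 2 (volume.restrict (perforatedBall c₁ R c₂ r)))
      atTop (𝓝 0))
    (ψG : Tendsto (fun k => eLpNorm (∇ (ψ k) - G) 2 (volume.restrict (perforatedBall c₁ R c₂ r)))
      atTop (𝓝 0)) :
    Tendsto (fun k => eLpNorm (ψ k + χ * (φ k - ψ k) - u) 2
        (volume.restrict (perforatedBall c₁ R c₂ r))) atTop (𝓝 0) ∧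
      Tendsto (fun k => eLpNorm (∇ (ψ k + χ * (φ k - ψ k)) - G) 2
        (volume.restrict (perforatedBall c₁ R c₂ r))) atTop (𝓝 0) := by
  obtain ⟨M, hM⟩ := exists_ae_norm_le_of_continuous hχ.continuous c₁ R c₂ r
  obtain ⟨M', hM'⟩ := exists_ae_norm_le_of_continuous (continuous_gradient hχ) c₁ R c₂ r
  have mu (θ : ℕ → Euc n → ℝ) (hθ : ∀ k, ContDiff ℝ 1 (θ k)) (k : ℕ) :=
    (hθ k).continuous.aestronglyMeasurable.sub hu
  have mG (θ : ℕ → Euc n → ℝ) (hθ : ∀ k, ContDiff ℝ 1 (θ k)) (k : ℕ) :=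
    (continuous_gradient (hθ k)).aestronglyMeasurable.sub hG
  have hd (k : ℕ) : ContDiff ℝ 1 (φ k - ψ k) := (hφ k).sub (hψ k)
  have hgrad (k : ℕ) : ∇ (φ k - ψ k) = ∇ (φ k) - ∇ (ψ k) := by
    rw [eq_sub_iff_add_eq]
    nth_rw 2 [← sub_add_cancel (φ k) (ψ k)]
    exact funext fun x => (gradient_add ((hd k).differentiable one_ne_zero x)
      ((hψ k).differentiable one_ne_zero x)).symm
  have hgrad' (k : ℕ) : ∇ (ψ k + χ * (φ k - ψ k)) = ∇ (ψ k) + ∇ (χ * (φ k - ψ k)) :=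
    funext fun x => gradient_add ((hψ k).differentiable one_ne_zero x)
      ((hχ.mul (hd k)).differentiable one_ne_zero x)
  have l := tendsto_eLpNorm_sub_zero (mu φ hφ) (mu ψ hψ) φu ψu
  have l' := tendsto_eLpNorm_sub_zero (mG φ hφ) (mG ψ hψ) φG ψG
  simp only [← hgrad] at l'
  simp only [hgrad', add_sub_right_comm]
  refine ⟨tendsto_eLpNorm_add_zero (mu ψ hψ)
    (fun k => (hχ.continuous.mul (hd k).continuous).aestronglyMeasurable) ψu
    (tendsto_eLpNorm_zero_of_norm_le_mul (M := M) (fun k => ?_) l),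
    tendsto_eLpNorm_add_zero (mG ψ hψ)
    (fun k => (continuous_gradient (hχ.mul (hd k))).aestronglyMeasurable) ψG
    (tendsto_eLpNorm_gradient_mul_zero hχ hM hM' hd l l')⟩
  filter_upwards [hM] with x hx
  rw [Pi.mul_apply, norm_mul]
  exact mul_le_mul_of_nonneg_right hx (norm_nonneg _)

theorem mem_topologicalClosure_range_smoothData {u : Euc n → ℝ} {G : Euc n → Euc n}
    {t s : Euc n → ℝ} (hu : MemLp u 2 (volume.restrict (perforatedBall c₁ R c₂ r)))
    (hG : MemLp G 2 (volume.restrict (perforatedBall c₁ R c₂ r)))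
    (ht : MemLp t 2 (surfaceMeasure c₁ R)) (hs : MemLp s 2 (surfaceMeasure c₂ r))
    {φ : ℕ → Euc n → ℝ} (hφ : ∀ k, ContDiff ℝ ∞ (φ k))
    (lu : Tendsto (fun k => eLpNorm (φ k - u) 2 (volume.restrict (perforatedBall c₁ R c₂ r)))
      atTop (𝓝 0))
    (lG : Tendsto (fun k => eLpNorm (∇ (φ k) - G) 2 (volume.restrict (perforatedBall c₁ R c₂ r)))
      atTop (𝓝 0))
    (lt : Tendsto (fun k => eLpNorm (φ k - t) 2 (surfaceMeasure c₁ R)) atTop (𝓝 0))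
    (ls : Tendsto (fun k => eLpNorm (φ k - s) 2 (surfaceMeasure c₂ r)) atTop (𝓝 0)) :
    ((hu.toLp u, hG.toLp G, ht.toLp t), hs.toLp s) ∈
      (LinearMap.range (smoothData c₁ R c₂ r)).topologicalClosure := by
  let Φ (k : ℕ) : smoothFunctions n := ⟨φ k, hφ k⟩
  refine mem_closure_of_tendsto (f := fun k => smoothData c₁ R c₂ r (Φ k)) (b := atTop) ?_
    (.of_forall fun k => LinearMap.mem_range_self _ _)
  exact .prodMk_nhds (.prodMk_nhds
    ((Lp.tendsto_Lp_iff_tendsto_eLpNorm'' _ (fun k => memLp_coe (Φ k) _ _ _ _) _ hu).2 lu)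
    (.prodMk_nhds
      ((Lp.tendsto_Lp_iff_tendsto_eLpNorm'' _ (fun k => memLp_gradient_coe (Φ k) _ _ _ _) _ hG).2
        lG)
      ((Lp.tendsto_Lp_iff_tendsto_eLpNorm'' _ (fun k => memLp_trace_coe (Φ k) _ _) _ ht).2 lt)))
    ((Lp.tendsto_Lp_iff_tendsto_eLpNorm'' _ (fun k => memLp_trace_coe (Φ k) _ _) _ hs).2 ls)

/-- The two traces of an admissible function may come from different approximating sequences; a
cutoff glues them to one. -/
theorem toLp_mem_admissibleSpace (hr : 0 ≤ r) (hR : 0 ≤ R) (h : closedBall c₂ r ⊆ ball c₁ R)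
    {u : Euc n → ℝ} {G : Euc n → Euc n} {t : Euc n → ℝ} (hu : IsAdmissible c₁ R c₂ r u G t) :
    (hu.isH1.memLp.toLp u, hu.isH1.memLp_grad.toLp G, hu.trace_outer.1.toLp t) ∈
      admissibleSpace c₁ R c₂ r := by
  obtain ⟨χ, hχ, hχ1, hχ0⟩ := exists_cutoff h
  obtain ⟨ht, φ, hφ, φu, φG, φt⟩ := hu.trace_outer
  obtain ⟨ht', ψ, hψ, ψu, ψG, ψt⟩ := hu.trace_inner
  obtain ⟨lu, lG⟩ := tendsto_eLpNorm_gluing hu.isH1.memLp.1 hu.isH1.memLp_grad.1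
    (hχ.of_le (by simp)) (fun k => (hφ k).of_le (by simp)) (fun k => (hψ k).of_le (by simp))
    φu φG ψu ψG
  have mem := mem_topologicalClosure_range_smoothData hu.isH1.memLp hu.isH1.memLp_grad ht ht'
    (fun k => (hψ k).add (hχ.mul ((hφ k).sub (hψ k)))) lu lG
    (φt.congr fun k => eLpNorm_congr_ae ?_) (ψt.congr fun k => eLpNorm_congr_ae ?_)
  · rwa [MemLp.toLp_zero] at mem
  · filter_upwards [ae_mem_sphere_surfaceMeasure c₁ hR] with x hx
    simp [hχ1 hx]
  · filter_upwards [ae_mem_sphere_surfaceMeasure c₂ hr] with x hx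
    simp [hχ0 hx]

end Cutoff

section Estimates

variable {n : ℕ} {c₁ c₂ : Euc n} {R r : ℝ}

theorem enorm_toLp_sq {α F : Type*} [MeasurableSpace α] {μ : Measure α} [NormedAddCommGroup F]
    {f : α → F} (hf : MemLp f 2 μ) : ‖hf.toLp f‖ₑ ^ 2 = ∫⁻ x, ‖f x‖ₑ ^ 2 ∂μ := by
  rw [Lp.enorm_toLp]
  simpa using eLpNorm_nnreal_pow_eq_lintegral (f := f) (μ := μ) (p := 2) two_ne_zero

theorem inner_toLp {α F : Type*} [MeasurableSpace α] {μ : Measure α} [NormedAddCommGroup F]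
    [InnerProductSpace ℝ F] {f g : α → F} (hf : MemLp f 2 μ) (hg : MemLp g 2 μ) :
    inner ℝ (hf.toLp f) (hg.toLp g) = ∫ x, inner ℝ (f x) (g x) ∂μ := by
  rw [L2.inner_def]
  refine integral_congr_ae ?_
  filter_upwards [hf.coeFn_toLp, hg.coeFn_toLp] with x hfx hgx
  rw [hfx, hgx]

theorem exists_norm_sq_eq_sum_setIntegral_sq {α ι : Type*} [MeasurableSpace α] {μ : Measure α}
    [IsFiniteMeasure μ] (t : Finset ι) {Q : ι → Set α} (hQ : ∀ i, MeasurableSet (Q i)) (C : ℝ≥0) :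
    ∃ L : Lp ℝ 2 μ →L[ℝ] EuclideanSpace ℝ t,
      ∀ f, ‖L f‖ ^ 2 = C * ∑ i ∈ t, (∫ x in Q i, f x ∂μ) ^ 2 := by
  let l (i : t) : Lp ℝ 2 μ →L[ℝ] ℝ :=
    innerSL ℝ (indicatorConstLp 2 (hQ i) (measure_ne_top μ _) (1 : ℝ))
  have hl (i : t) (f : Lp ℝ 2 μ) : l i f = ∫ x in Q i, f x ∂μ :=
    L2.inner_indicatorConstLp_one (hQ i) (measure_ne_top μ _) f
  let L : Lp ℝ 2 μ →L[ℝ] EuclideanSpace ℝ t :=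
    (EuclideanSpace.equiv t ℝ).symm.toContinuousLinearMap ∘L ContinuousLinearMap.pi l
  refine ⟨√C • L, fun f => ?_⟩
  rw [_root_.smul_apply, norm_smul, mul_pow, Real.norm_eq_abs, sq_abs, Real.sq_sqrt C.coe_nonneg,
    EuclideanSpace.real_norm_sq_eq,
    ← Finset.sum_coe_sort t fun i => (∫ x in Q i, f x ∂μ) ^ 2]
  exact congrArg _ (Finset.sum_congr rfl fun i _ => congrArg (· ^ 2) (hl i f))

theorem enorm_smoothData_gradient_sq (φ : smoothFunctions n) :
    ‖(smoothData c₁ R c₂ r φ).1.2.1‖ₑ ^ 2 =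
      ∫⁻ x in perforatedBall c₁ R c₂ r, ‖fderiv ℝ φ.1 x‖ₑ ^ 2 := by
  refine (enorm_toLp_sq (memLp_gradient_coe φ c₁ R c₂ r)).trans (lintegral_congr fun x => ?_)
  rw [← ofReal_norm, norm_gradient, ofReal_norm]

variable [NeZero n]

theorem exists_norm_sq_le_norm_gradient_sq (hr : 0 < r) (h : closedBall c₂ r ⊆ ball c₁ R) :
    ∃ C : ℝ≥0, ∀ x ∈ admissibleSpace c₁ R c₂ r, ‖x.1‖ ^ 2 ≤ C * ‖x.2.1‖ ^ 2 := by
  obtain ⟨C, hC⟩ := exists_poincare (F := ℝ) hr h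
  refine ⟨C, fun x hx => ?_⟩
  have := admissibleSpace_induction (P := {y | ‖y.1.1‖ ^ 2 ≤ C * (‖y.1.2.1‖ ^ 2 + ‖y.2‖ ^ 2)})
    (isClosed_le (by fun_prop) (by fun_prop)) (fun φ => ?_) hx
  · simpa using this
  · have hφ := hC φ.1 (contDiff_one_coe φ)
    rw [← enorm_smoothData_gradient_sq, ← enorm_toLp_sq (memLp_coe φ c₁ R c₂ r),
      ← enorm_toLp_sq (memLp_trace_coe φ c₂ r)] at hφ
    simp only [enorm_eq_nnnorm] at hφ
    exact_mod_cast hφ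

theorem exists_norm_trace_sq_le_add (hR : 0 < R) (h : closedBall c₂ r ⊆ ball c₁ R) {ε : ℝ}
    (hε : 0 < ε) :
    ∃ (t : Finset (Euc n))
      (L : Lp ℝ 2 (volume.restrict (perforatedBall c₁ R c₂ r)) →L[ℝ] EuclideanSpace ℝ t),
      ∀ x ∈ admissibleSpace c₁ R c₂ r, ‖x.2.2‖ ^ 2 ≤ ε * ‖x.2.1‖ ^ 2 + ‖L x.1‖ ^ 2 := by
  obtain ⟨t, δ, C, hsub, htrace⟩ := exists_trace_sq_le_averages (F := ℝ) hR h hε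
  have : IsFiniteMeasure (volume.restrict (perforatedBall c₁ R c₂ r)) :=
    isFiniteMeasure_restrict.2 (volume_perforatedBall_ne_top c₁ R c₂ r)
  obtain ⟨L, hL⟩ := exists_norm_sq_eq_sum_setIntegral_sq
    (μ := volume.restrict (perforatedBall c₁ R c₂ r)) t
    (Q := fun c => ball c δ) (fun _ => measurableSet_ball) C
  refine ⟨t, L, fun x hx => ?_⟩
  refine admissibleSpace_induction
    (P := {y | ‖y.1.2.2‖ ^ 2 ≤ ε * ‖y.1.2.1‖ ^ 2 + ‖L y.1.1‖ ^ 2})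
    (isClosed_le (by fun_prop) (by fun_prop)) (fun φ => ?_) hx
  have haverage : ∑ c ∈ t, (∫ x in ball c δ, (smoothData c₁ R c₂ r φ).1.1 x
      ∂volume.restrict (perforatedBall c₁ R c₂ r)) ^ 2 = ∑ c ∈ t, ‖∫ x in ball c δ, φ.1 x‖ ^ 2 := by
    refine Finset.sum_congr rfl fun c hc => ?_
    rw [Real.norm_eq_abs, sq_abs, Measure.restrict_restrict measurableSet_ball,
      inter_eq_left.2 (hsub c hc)]
    exact congrArg (· ^ 2) (integral_congr_ae (ae_mono (Measure.restrict_mono_set _ (hsub c hc))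
      (memLp_coe φ c₁ R c₂ r).coeFn_toLp))
  have hφ := htrace φ.1 (contDiff_one_coe φ)
  rw [← enorm_smoothData_gradient_sq, ← enorm_toLp_sq (memLp_trace_coe φ c₁ R)] at hφ
  rw [Set.mem_ofPred_eq, hL, haverage]
  lift ε to ℝ≥0 using hε.le
  simp only [enorm_eq_nnnorm, ENNReal.ofReal_coe_nnreal] at hφ
  norm_cast at hφ
  rw [← NNReal.coe_le_coe] at hφ
  push_cast at hφ
  exact hφ

theorem exists_norm_le_norm_gradient (hr : 0 < r) (hR : 0 < R)
    (h : closedBall c₂ r ⊆ ball c₁ R) :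
    ∃ C : ℝ≥0, ∀ x ∈ admissibleSpace c₁ R c₂ r, ‖x‖ ≤ C * ‖x.2.1‖ := by
  obtain ⟨C, hC⟩ := exists_norm_sq_le_norm_gradient_sq hr h
  obtain ⟨t, L, hL⟩ := exists_norm_trace_sq_le_add hR h one_pos
  let A : ℝ≥0 := 1 + C + ‖L‖₊ ^ 2 * C
  refine ⟨NNReal.sqrt A, fun x hx => ?_⟩
  have le_of_sq_le {a : ℝ} (ha : a ^ 2 ≤ A * ‖x.2.1‖ ^ 2) : a ≤ NNReal.sqrt A * ‖x.2.1‖ := by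
    refine le_of_sq_le_sq ?_ (by positivity)
    rwa [mul_pow, ← NNReal.coe_pow, NNReal.sq_sqrt]
  have htrace : ‖x.2.2‖ ^ 2 ≤ (1 + ‖L‖ ^ 2 * C) * ‖x.2.1‖ ^ 2 :=
    calc ‖x.2.2‖ ^ 2 ≤ 1 * ‖x.2.1‖ ^ 2 + ‖L x.1‖ ^ 2 := hL x hx
      _ ≤ 1 * ‖x.2.1‖ ^ 2 + (‖L‖ * ‖x.1‖) ^ 2 := by gcongr; exact L.le_opNorm _
      _ ≤ 1 * ‖x.2.1‖ ^ 2 + ‖L‖ ^ 2 * (C * ‖x.2.1‖ ^ 2) := by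
        rw [mul_pow]
        gcongr
        exact hC x hx
      _ = _ := by ring
  have hA : (A : ℝ) = 1 + C + ‖L‖ ^ 2 * C := by simp [A]
  have hLC : 0 ≤ ‖L‖ ^ 2 * C := by positivity
  refine max_le (le_of_sq_le ((hC x hx).trans ?_)) (max_le (le_of_sq_le ?_)
    (le_of_sq_le (htrace.trans ?_)))
  · gcongr
    linarith
  · exact le_mul_of_one_le_left (sq_nonneg _) (by linarith [C.2])
  · gcongr
    linarith [C.2]

end Estimates

section TestFunction

variable {n : ℕ} {c₁ c₂ : Euc n} {R r : ℝ}

theorem memLp_sphereMeasure_coe (φ : smoothFunctions n) (c : Euc n) (ρ : ℝ) :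
    MemLp (fun w : sphere (0 : Euc n) 1 => φ.1 (c + ρ • (w : Euc n))) 2 (sphereMeasure n) := by
  have hφ := (contDiff_coe φ).continuous
  exact Continuous.memLp_of_hasCompactSupport (by fun_prop) (.of_compactSpace _)

theorem norm_toLp_trace_coe (φ : smoothFunctions n) (c : Euc n) {ρ : ℝ} (hρ : 0 ≤ ρ) :
    ‖(memLp_trace_coe φ c ρ).toLp φ.1‖ =
      √(ρ ^ (n - 1)) * ‖(memLp_sphereMeasure_coe φ c ρ).toLp _‖ := by
  have hsq : ‖(memLp_trace_coe φ c ρ).toLp φ.1‖ ^ 2 =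
      ρ ^ (n - 1) * ‖(memLp_sphereMeasure_coe φ c ρ).toLp _‖ ^ 2 := by
    have h := enorm_toLp_sq (memLp_trace_coe φ c ρ)
    rw [lintegral_surfaceMeasure c ρ (measurable_enorm_sq (contDiff_coe φ).continuous),
      ← enorm_toLp_sq (memLp_sphereMeasure_coe φ c ρ), ← ofReal_norm, ← ofReal_norm,
      ← ENNReal.ofReal_pow (norm_nonneg _), ← ENNReal.ofReal_pow (norm_nonneg _),
      ← ENNReal.ofReal_mul (by positivity)] at h
    exact (ENNReal.ofReal_eq_ofReal_iff (by positivity) (by positivity)).1 h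
  rw [← Real.sqrt_sq (norm_nonneg _), hsq, Real.sqrt_mul (by positivity),
    Real.sqrt_sq (norm_nonneg _)]

theorem smoothData_mem_admissibleSpace (hr : 0 ≤ r) (φ : smoothFunctions n)
    (hφ : ∀ x ∈ sphere c₂ r, φ.1 x = 0) :
    (smoothData c₁ R c₂ r φ).1 ∈ admissibleSpace c₁ R c₂ r := by
  have h0 : (smoothData c₁ R c₂ r φ).2 = 0 := by
    rw [Lp.eq_zero_iff_ae_eq_zero]
    filter_upwards [(memLp_trace_coe φ c₂ r).coeFn_toLp, ae_mem_sphere_surfaceMeasure c₂ hr]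
      with x hx hxS
    exact hx.trans (hφ x hxS)
  refine subset_closure ⟨φ, ?_⟩
  rw [LinearMap.inl_apply, ← h0]

/-- The radial harmonic function about the centre of the hole, truncated inside the hole; it is the
test function for the upper bound on the first eigenvalue. -/
def testFunction (hr : 0 < r) (c : Euc n) : smoothFunctions n :=
  ⟨radialPotential (n - 1) r c, contDiff_radialPotential (n - 1) hr c⟩

theorem smoothData_testFunction_mem_admissibleSpace (hr : 0 < r) :
    (smoothData c₁ R c₂ r (testFunction hr c₂)).1 ∈ admissibleSpace c₁ R c₂ r := by
  refine smoothData_mem_admissibleSpace hr.le _ fun x hx => ?_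
  have hx : ‖x - c₂‖ = r := mem_sphere_iff_norm.1 hx
  change radialPotential (n - 1) r c₂ x = 0
  rw [radialPotential_eq_radialResistance _ hr hx.ge, hx, radialResistance,
    intervalIntegral.integral_same]

theorem le_norm_trace_testFunction_sq (hn : 2 ≤ n) (hr : 0 < r) (hrR : r < R)
    (h : closedBall c₂ r ⊆ ball c₁ R) :
    R ^ (n - 1) * (radialResistance (n - 1) r R ^ 2 * (sphereMeasure n).real univ) ≤
      ‖(smoothData c₁ R c₂ r (testFunction hr c₂)).1.2.2‖ ^ 2 := by
  have hR : 0 < R := hr.trans hrR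
  have : NeZero n := ⟨by omega⟩
  have hsphere : 0 < (sphereMeasure n).real univ := measureReal_univ_pos
  have hmean := le_average_radialPotential_sq hn hr hrR h
  rw [average_eq, smul_eq_mul, inv_mul_eq_div, le_div_iff₀ hsphere] at hmean
  calc R ^ (n - 1) * (radialResistance (n - 1) r R ^ 2 * (sphereMeasure n).real univ)
      ≤ R ^ (n - 1) * ∫ w : sphere (0 : Euc n) 1,
          radialPotential (n - 1) r c₂ (c₁ + R • (w : Euc n)) ^ 2 ∂(sphereMeasure n) := by gcongr
    _ = R ^ (n - 1) * ‖(memLp_sphereMeasure_coe (testFunction hr c₂) c₁ R).toLp _‖ ^ 2 := by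
        rw [← real_inner_self_eq_norm_sq, inner_toLp]
        simp only [RCLike.inner_apply, conj_trivial, ← sq]
        rfl
    _ = (√(R ^ (n - 1)) * ‖(memLp_sphereMeasure_coe (testFunction hr c₂) c₁ R).toLp _‖) ^ 2 := by
        rw [mul_pow, Real.sq_sqrt (by positivity)]
    _ = _ := by rw [← norm_toLp_trace_coe _ c₁ hR.le]; rfl

theorem ofReal_norm_gradient_testFunction_sq (hr : 0 < r) :
    ENNReal.ofReal (‖(smoothData c₁ R c₂ r (testFunction hr c₂)).1.2.1‖ ^ 2) =
      ∫⁻ x in perforatedBall c₁ R c₂ r, ‖∇ (radialPotential (n - 1) r c₂) x‖ₑ ^ 2 := by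
  rw [ENNReal.ofReal_pow (norm_nonneg _), ofReal_norm]
  exact enorm_toLp_sq (memLp_gradient_coe (testFunction hr c₂) c₁ R c₂ r)

theorem norm_gradient_testFunction_sq_le [NeZero n] (hr : 0 < r) (hrR : r < R)
    (h : closedBall c₂ r ⊆ ball c₁ R) :
    ‖(smoothData c₁ R c₂ r (testFunction hr c₂)).1.2.1‖ ^ 2 ≤
      radialResistance (n - 1) r R * (sphereMeasure n).real univ := by
  have hΦ := (radialResistance_pos (n - 1) hr hrR).le
  rw [← ENNReal.ofReal_le_ofReal_iff (by positivity), ofReal_norm_gradient_testFunction_sq,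
    ENNReal.ofReal_mul hΦ, ofReal_measureReal]
  exact lintegral_gradient_radialPotential_le hr hrR h

theorem norm_gradient_testFunction_sq_lt (hn : 2 ≤ n) (hr : 0 < r) (hrR : r < R)
    (h : closedBall c₂ r ⊆ ball c₁ R) (hne : c₁ ≠ c₂) :
    ‖(smoothData c₁ R c₂ r (testFunction hr c₂)).1.2.1‖ ^ 2 <
      radialResistance (n - 1) r R * (sphereMeasure n).real univ := by
  have hΦ := (radialResistance_pos (n - 1) hr hrR).le
  rw [← ENNReal.ofReal_lt_ofReal_iff_of_nonneg (sq_nonneg _), ofReal_norm_gradient_testFunction_sq,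
    ENNReal.ofReal_mul hΦ, ofReal_measureReal]
  exact lintegral_gradient_radialPotential_lt hn hr hrR h hne

theorem norm_trace_sub_le [NeZero n] (hr : 0 < r) (hrR : r ≤ R) (c : Euc n)
    (φ : smoothFunctions n) :
    ‖(memLp_sphereMeasure_coe φ c R).toLp _ - (memLp_sphereMeasure_coe φ c r).toLp _‖ ≤
      √(radialResistance (n - 1) r R) * ‖(smoothData c R c r φ).1.2.1‖ := by
  have hΦ : 0 ≤ radialResistance (n - 1) r R := intervalIntegral.integral_nonneg hrR fun s hs =>
    inv_nonneg.2 (pow_nonneg (hr.le.trans hs.1) _)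
  have hsub : ‖(memLp_sphereMeasure_coe φ c R).toLp _ -
      (memLp_sphereMeasure_coe φ c r).toLp _‖ₑ ^ 2 = ∫⁻ w : sphere (0 : Euc n) 1,
        ‖φ.1 (c + R • (w : Euc n)) - φ.1 (c + r • (w : Euc n))‖ₑ ^ 2 ∂(sphereMeasure n) :=
    enorm_toLp_sq ((memLp_sphereMeasure_coe φ c R).sub (memLp_sphereMeasure_coe φ c r))
  have hrays := lintegral_sphere_sub_sq_le (contDiff_one_coe φ) c hr hrR
  rw [← hsub, ← enorm_smoothData_gradient_sq, ← ofReal_norm, ← ofReal_norm,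
    ← ENNReal.ofReal_pow (norm_nonneg _), ← ENNReal.ofReal_pow (norm_nonneg _),
    ← ENNReal.ofReal_mul hΦ, ENNReal.ofReal_le_ofReal_iff (by positivity)] at hrays
  refine le_of_sq_le_sq ?_ (by positivity)
  rwa [mul_pow, Real.sq_sqrt hΦ]

theorem norm_trace_sq_le_of_concentric [NeZero n] (hr : 0 < r) (hrR : r < R) {c : Euc n}
    {x : TraceTriple c R c r} (hx : x ∈ admissibleSpace c R c r) :
    ‖x.2.2‖ ^ 2 ≤ R ^ (n - 1) * radialResistance (n - 1) r R * ‖x.2.1‖ ^ 2 := by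
  have hR : 0 < R := hr.trans hrR
  have hΦ := radialResistance_pos (n - 1) hr hrR
  have htrace := admissibleSpace_induction (P := {y | ‖y.1.2.2‖ ≤ √(R ^ (n - 1)) *
    (√(radialResistance (n - 1) r R) * ‖y.1.2.1‖ + (√(r ^ (n - 1)))⁻¹ * ‖y.2‖)})
    (isClosed_le (by fun_prop) (by fun_prop)) (fun φ => ?_) hx
  · have htrace : ‖x.2.2‖ ≤ √(R ^ (n - 1)) * (√(radialResistance (n - 1) r R) * ‖x.2.1‖) := by
      simpa using htrace
    calc ‖x.2.2‖ ^ 2 ≤ (√(R ^ (n - 1)) * (√(radialResistance (n - 1) r R) * ‖x.2.1‖)) ^ 2 := by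
          gcongr
      _ = _ := by
        rw [mul_pow, mul_pow, Real.sq_sqrt (by positivity), Real.sq_sqrt hΦ.le, mul_assoc]
  · set f := (memLp_sphereMeasure_coe φ c R).toLp _
    set g := (memLp_sphereMeasure_coe φ c r).toLp _
    have hg : ‖g‖ = (√(r ^ (n - 1)))⁻¹ * ‖(smoothData c R c r φ).2‖ := by
      rw [eq_inv_mul_iff_mul_eq₀ (by positivity)]
      exact (norm_toLp_trace_coe φ c hr.le).symm
    calc ‖(smoothData c R c r φ).1.2.2‖ = √(R ^ (n - 1)) * ‖f‖ := norm_toLp_trace_coe φ c hR.le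
      _ ≤ √(R ^ (n - 1)) * (‖f - g‖ + ‖g‖) := by
        gcongr
        exact norm_le_norm_sub_add f g
      _ ≤ √(R ^ (n - 1)) * (√(radialResistance (n - 1) r R) * ‖(smoothData c R c r φ).1.2.1‖ +
          (√(r ^ (n - 1)))⁻¹ * ‖(smoothData c R c r φ).2‖) := by
        rw [← hg]
        gcongr
        exact norm_trace_sub_le hr hrR.le c φ

end TestFunction

section Eigenvalues

variable {n : ℕ} {c₁ c₂ : Euc n} {R r : ℝ}

theorem gradient_ae_eq_zero_of_ae_eq_zero {u : Euc n → ℝ} {G : Euc n → Euc n} {Ω : Set (Euc n)}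
    (hΩ : IsOpen Ω) (hvol : volume Ω ≠ ⊤) (h : IsH1 Ω u G) (hu : u =ᵐ[volume.restrict Ω] 0) :
    G =ᵐ[volume.restrict Ω] 0 := by
  have : IsFiniteMeasure (volume.restrict Ω) := isFiniteMeasure_restrict.2 hvol
  have hG : IntegrableOn G Ω := h.memLp_grad.integrable one_le_two
  rw [EventuallyEq, ae_restrict_iff' hΩ.measurableSet]
  refine hΩ.ae_eq_zero_of_integral_contDiff_smul_eq_zero hG.locallyIntegrableOn
    fun ψ hψ hc hs => ext_inner_right ℝ fun v => ?_
  have hψ : ContDiff ℝ ∞ ψ := hψ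
  have hψ0 (x : Euc n) (hx : x ∉ Ω) : ψ x = 0 :=
    image_eq_zero_of_notMem_tsupport fun h => hx (hs h)
  obtain ⟨C, hC⟩ := hψ.continuous.bounded_above_of_compact_support hc
  have hint : Integrable (fun x => ψ x • G x) (volume.restrict Ω) :=
    hG.bdd_smul C hψ.continuous.aestronglyMeasurable (ae_of_all _ hC)
  calc inner ℝ (∫ x, ψ x • G x) v = inner ℝ (∫ x in Ω, ψ x • G x) v := by
        rw [setIntegral_eq_integral_of_forall_compl_eq_zero fun x hx => by simp [hψ0 x hx]]
    _ = ∫ x in Ω, inner ℝ (G x) v * ψ x := by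
        rw [real_inner_comm, ← integral_inner hint]
        simp only [inner_smul_right, real_inner_comm, mul_comm]
    _ = - ∫ x in Ω, u x * fderiv ℝ ψ x v := by rw [h.weak_grad ψ hψ hc hs v, neg_neg]
    _ = 0 := by
        rw [integral_eq_zero_of_ae (hu.mono fun x hx => by simp [hx]), neg_zero]
    _ = inner ℝ 0 v := (inner_zero_left v).symm

theorem isEigenvalue_inv (hr : 0 ≤ r) (hR : 0 ≤ R) (h : closedBall c₂ r ⊆ ball c₁ R) {m : ℝ}
    (hm : m ≠ 0) {x : TraceTriple c₁ R c₂ r} (hx : x ∈ admissibleSpace c₁ R c₂ r) (hx0 : x.2.1 ≠ 0)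
    (hcrit : ∀ y ∈ admissibleSpace c₁ R c₂ r, inner ℝ x.2.2 y.2.2 = m * inner ℝ x.2.1 y.2.1) :
    IsEigenvalue c₁ R c₂ r m⁻¹ := by
  have hadm := isAdmissible_of_mem_admissibleSpace hx
  refine ⟨x.1, x.2.1, x.2.2, hadm, fun h0 => hx0 ?_, fun v H s hv => ?_⟩
  · rw [Lp.eq_zero_iff_ae_eq_zero]
    exact gradient_ae_eq_zero_of_ae_eq_zero (isOpen_ball.sdiff isClosed_closedBall)
      (volume_perforatedBall_ne_top c₁ R c₂ r) hadm.isH1 h0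
  · have hvar := hcrit _ (toLp_mem_admissibleSpace hr hR h hv)
    rw [← Lp.toLp_coeFn x.2.1 (Lp.memLp _), ← Lp.toLp_coeFn x.2.2 (Lp.memLp _), inner_toLp,
      inner_toLp] at hvar
    rw [eq_inv_mul_iff_mul_eq₀ hm, ← hvar]
    simp only [RCLike.inner_apply, conj_trivial, mul_comm]

theorem eq_zero_of_gradient_eq_zero [NeZero n] (hr : 0 < r) (hR : 0 < R)
    (h : closedBall c₂ r ⊆ ball c₁ R) {x : TraceTriple c₁ R c₂ r}
    (hx : x ∈ admissibleSpace c₁ R c₂ r) (h0 : x.2.1 = 0) : x = 0 := by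
  obtain ⟨C, hC⟩ := exists_norm_le_norm_gradient hr hR h
  simpa [h0] using hC x hx

theorem exists_norm_gradient_sq_eq_of_isEigenvalue [NeZero n] (hr : 0 < r) (hR : 0 < R)
    (h : closedBall c₂ r ⊆ ball c₁ R) {τ : ℝ} (hτ : IsEigenvalue c₁ R c₂ r τ) :
    ∃ x ∈ admissibleSpace c₁ R c₂ r, x.2.1 ≠ 0 ∧ ‖x.2.1‖ ^ 2 = τ * ‖x.2.2‖ ^ 2 := by
  obtain ⟨u, G, t, hadm, hu, hvar⟩ := hτ
  have hmem := toLp_mem_admissibleSpace hr.le hR.le h hadm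
  refine ⟨_, hmem, fun h0 => hu ?_, ?_⟩
  · have h1 : hadm.isH1.memLp.toLp u = 0 :=
      congrArg Prod.fst (eq_zero_of_gradient_eq_zero hr hR h hmem h0)
    exact hadm.isH1.memLp.coeFn_toLp.symm.trans ((Lp.eq_zero_iff_ae_eq_zero).1 h1)
  · rw [← real_inner_self_eq_norm_sq, ← real_inner_self_eq_norm_sq, inner_toLp, inner_toLp,
      hvar u G t hadm]
    simp only [RCLike.inner_apply, conj_trivial]

theorem inv_le_of_isEigenvalue [NeZero n] (hr : 0 < r) (hR : 0 < R)
    (h : closedBall c₂ r ⊆ ball c₁ R) {m : ℝ} (hm : 0 < m)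
    (hmax : ∀ x ∈ admissibleSpace c₁ R c₂ r, ‖x.2.2‖ ^ 2 ≤ m * ‖x.2.1‖ ^ 2) {τ : ℝ}
    (hτ : IsEigenvalue c₁ R c₂ r τ) : m⁻¹ ≤ τ := by
  obtain ⟨x, hx, hx0, hquot⟩ := exists_norm_gradient_sq_eq_of_isEigenvalue hr hR h hτ
  have hgrad : 0 < ‖x.2.1‖ ^ 2 := by positivity
  have htrace : 0 < ‖x.2.2‖ ^ 2 := (sq_nonneg _).lt_of_ne fun h0 => by
    rw [hquot, ← h0, mul_zero] at hgrad
    exact hgrad.false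
  rw [inv_le_iff_one_le_mul₀' hm]
  refine le_of_mul_le_mul_right ?_ htrace
  calc 1 * ‖x.2.2‖ ^ 2 ≤ m * ‖x.2.1‖ ^ 2 := (one_mul _).trans_le (hmax x hx)
    _ = m * τ * ‖x.2.2‖ ^ 2 := by rw [hquot, mul_assoc]

theorem exists_norm_trace_sq_le_and_inner_eq (hn : 2 ≤ n) (hr : 0 < r) (hrR : r < R)
    (h : closedBall c₂ r ⊆ ball c₁ R) :
    ∃ m > 0, (∀ y ∈ admissibleSpace c₁ R c₂ r, ‖y.2.2‖ ^ 2 ≤ m * ‖y.2.1‖ ^ 2) ∧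
      ∃ x ∈ admissibleSpace c₁ R c₂ r, x.2.1 ≠ 0 ∧
        ∀ y ∈ admissibleSpace c₁ R c₂ r, inner ℝ x.2.2 y.2.2 = m * inner ℝ x.2.1 y.2.1 := by
  have : NeZero n := ⟨by omega⟩
  have hR : 0 < R := hr.trans hrR
  obtain ⟨C, hC⟩ := exists_norm_le_norm_gradient hr hR h
  let ι := (admissibleSpace c₁ R c₂ r).subtypeL
  let g := ContinuousLinearMap.fst ℝ _ _ ∘L ContinuousLinearMap.snd ℝ _ _ ∘L ι
  let T := ContinuousLinearMap.snd ℝ _ _ ∘L ContinuousLinearMap.snd ℝ _ _ ∘L ι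
  have hg : AntilipschitzWith C g := g.antilipschitz_of_bound fun x => hC x.1 x.2
  have hT : IsCompactOperator T := isCompactOperator_of_norm_sq_le_add T fun ε hε => by
    obtain ⟨t, L, hL⟩ := exists_norm_trace_sq_le_add hR h hε
    refine ⟨EuclideanSpace ℝ t, inferInstance, inferInstance, inferInstance,
      L ∘L ContinuousLinearMap.fst ℝ _ _ ∘L ι, fun x => (hL x.1 x.2).trans ?_⟩
    have hx : ‖x.1.2.1‖ ≤ ‖x‖ := (norm_fst_le x.1.2).trans (norm_snd_le x.1)
    exact add_le_add_left (by gcongr) _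
  have hT0 : T ≠ 0 := fun h0 => by
    have hΦ := radialResistance_pos (n - 1) hr hrR
    have hsphere : 0 < (sphereMeasure n).real univ := measureReal_univ_pos
    have hpos : 0 < R ^ (n - 1) *
      (radialResistance (n - 1) r R ^ 2 * (sphereMeasure n).real univ) := by positivity
    have htrace : (smoothData c₁ R c₂ r (testFunction hr c₂)).1.2.2 = 0 :=
      congrArg (fun A => A ⟨_, smoothData_testFunction_mem_admissibleSpace hr⟩) h0
    have := hpos.trans_le (le_norm_trace_testFunction_sq hn hr hrR h)
    simp [htrace] at this
  obtain ⟨m, hm, hmax, x, hx0, hcrit⟩ := exists_inner_eq_mul_inner hg hT hT0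
  exact ⟨m, hm, fun y hy => hmax ⟨y, hy⟩, x, x.2,
    fun h0 => hx0 (Subtype.ext (eq_zero_of_gradient_eq_zero hr hR h x.2 h0)),
    fun y hy => hcrit ⟨y, hy⟩⟩

theorem isLeast_nonzeroEigenvalues_inv [NeZero n] (hr : 0 < r) (hR : 0 < R)
    (h : closedBall c₂ r ⊆ ball c₁ R) {m : ℝ} (hm : 0 < m)
    (hmax : ∀ y ∈ admissibleSpace c₁ R c₂ r, ‖y.2.2‖ ^ 2 ≤ m * ‖y.2.1‖ ^ 2)
    {x : TraceTriple c₁ R c₂ r} (hx : x ∈ admissibleSpace c₁ R c₂ r) (hx0 : x.2.1 ≠ 0)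
    (hcrit : ∀ y ∈ admissibleSpace c₁ R c₂ r, inner ℝ x.2.2 y.2.2 = m * inner ℝ x.2.1 y.2.1) :
    IsLeast (nonzeroEigenvalues c₁ R c₂ r) m⁻¹ :=
  ⟨⟨(inv_pos.2 hm).ne', isEigenvalue_inv hr.le hR.le h hm.ne' hx hx0 hcrit⟩,
    fun _ hτ => inv_le_of_isEigenvalue hr hR h hm hmax hτ.2⟩

theorem exists_isLeast_nonzeroEigenvalues_inv (hn : 2 ≤ n) (hr : 0 < r) (hrR : r < R)
    (h : closedBall c₂ r ⊆ ball c₁ R) :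
    ∃ m > 0, IsLeast (nonzeroEigenvalues c₁ R c₂ r) m⁻¹ ∧
      (∀ x ∈ admissibleSpace c₁ R c₂ r, ‖x.2.2‖ ^ 2 ≤ m * ‖x.2.1‖ ^ 2) ∧
      ∃ x ∈ admissibleSpace c₁ R c₂ r, x.2.1 ≠ 0 ∧ ‖x.2.2‖ ^ 2 = m * ‖x.2.1‖ ^ 2 := by
  have : NeZero n := ⟨by omega⟩
  obtain ⟨m, hm, hmax, x, hx, hx0, hcrit⟩ := exists_norm_trace_sq_le_and_inner_eq hn hr hrR h
  refine ⟨m, hm, isLeast_nonzeroEigenvalues_inv hr (hr.trans hrR) h hm hmax hx hx0 hcrit, hmax,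
    x, hx, hx0, ?_⟩
  rw [← real_inner_self_eq_norm_sq, hcrit x hx, real_inner_self_eq_norm_sq]

theorem isLeast_firstEigenvalue (hn : 2 ≤ n) (hr : 0 < r) (hrR : r < R)
    (h : closedBall c₂ r ⊆ ball c₁ R) :
    IsLeast (nonzeroEigenvalues c₁ R c₂ r) (firstEigenvalue c₁ R c₂ r) := by
  obtain ⟨m, -, hleast, -⟩ := exists_isLeast_nonzeroEigenvalues_inv hn hr hrR h
  rwa [firstEigenvalue, hleast.csInf_eq]

theorem firstEigenvalue_pos (hn : 2 ≤ n) (hr : 0 < r) (hrR : r < R)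
    (h : closedBall c₂ r ⊆ ball c₁ R) : 0 < firstEigenvalue c₁ R c₂ r := by
  obtain ⟨m, hm, hleast, -⟩ := exists_isLeast_nonzeroEigenvalues_inv hn hr hrR h
  rw [firstEigenvalue, hleast.csInf_eq]
  exact inv_pos.2 hm

theorem firstEigenvalue_mul_norm_trace_sq_le (hn : 2 ≤ n) (hr : 0 < r) (hrR : r < R)
    (h : closedBall c₂ r ⊆ ball c₁ R) {x : TraceTriple c₁ R c₂ r}
    (hx : x ∈ admissibleSpace c₁ R c₂ r) :
    firstEigenvalue c₁ R c₂ r * ‖x.2.2‖ ^ 2 ≤ ‖x.2.1‖ ^ 2 := by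
  obtain ⟨m, hm, hleast, hmax, -⟩ := exists_isLeast_nonzeroEigenvalues_inv hn hr hrR h
  rw [firstEigenvalue, hleast.csInf_eq, inv_mul_le_iff₀ hm]
  exact hmax x hx

theorem exists_firstEigenvalue_mul_norm_trace_sq_eq (hn : 2 ≤ n) (hr : 0 < r) (hrR : r < R)
    (h : closedBall c₂ r ⊆ ball c₁ R) :
    ∃ x ∈ admissibleSpace c₁ R c₂ r, x.2.1 ≠ 0 ∧
      firstEigenvalue c₁ R c₂ r * ‖x.2.2‖ ^ 2 = ‖x.2.1‖ ^ 2 := by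
  obtain ⟨m, hm, hleast, -, x, hx, hx0, heq⟩ := exists_isLeast_nonzeroEigenvalues_inv hn hr hrR h
  refine ⟨x, hx, hx0, ?_⟩
  rw [firstEigenvalue, hleast.csInf_eq, heq, inv_mul_cancel_left₀ hm.ne']

theorem firstEigenvalue_mul_le_norm_gradient_testFunction_sq (hn : 2 ≤ n) (hr : 0 < r)
    (hrR : r < R) (h : closedBall c₂ r ⊆ ball c₁ R) :
    firstEigenvalue c₁ R c₂ r * (R ^ (n - 1) * radialResistance (n - 1) r R) *
        (radialResistance (n - 1) r R * (sphereMeasure n).real univ) ≤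
      ‖(smoothData c₁ R c₂ r (testFunction hr c₂)).1.2.1‖ ^ 2 :=
  calc _ = firstEigenvalue c₁ R c₂ r *
        (R ^ (n - 1) * (radialResistance (n - 1) r R ^ 2 * (sphereMeasure n).real univ)) := by ring
    _ ≤ firstEigenvalue c₁ R c₂ r *
        ‖(smoothData c₁ R c₂ r (testFunction hr c₂)).1.2.2‖ ^ 2 :=
      mul_le_mul_of_nonneg_left (le_norm_trace_testFunction_sq hn hr hrR h)
        (firstEigenvalue_pos hn hr hrR h).le
    _ ≤ _ := firstEigenvalue_mul_norm_trace_sq_le hn hr hrR h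
      (smoothData_testFunction_mem_admissibleSpace hr)

theorem firstEigenvalue_le (hn : 2 ≤ n) (hr : 0 < r) (hrR : r < R)
    (h : closedBall c₂ r ⊆ ball c₁ R) :
    firstEigenvalue c₁ R c₂ r ≤ (R ^ (n - 1) * radialResistance (n - 1) r R)⁻¹ := by
  have : NeZero n := ⟨by omega⟩
  have hΦ := radialResistance_pos (n - 1) hr hrR
  have hsphere : 0 < (sphereMeasure n).real univ := measureReal_univ_pos
  rw [← one_div, le_div_iff₀ (mul_pos (pow_pos (hr.trans hrR) _) hΦ)]
  refine le_of_mul_le_mul_right ?_ (mul_pos hΦ hsphere)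
  rw [one_mul]
  exact (firstEigenvalue_mul_le_norm_gradient_testFunction_sq hn hr hrR h).trans
    (norm_gradient_testFunction_sq_le hr hrR h)

theorem firstEigenvalue_lt (hn : 2 ≤ n) (hr : 0 < r) (hrR : r < R)
    (h : closedBall c₂ r ⊆ ball c₁ R) (hne : c₁ ≠ c₂) :
    firstEigenvalue c₁ R c₂ r < (R ^ (n - 1) * radialResistance (n - 1) r R)⁻¹ := by
  have hΦ := radialResistance_pos (n - 1) hr hrR
  rw [← one_div, lt_div_iff₀ (mul_pos (pow_pos (hr.trans hrR) _) hΦ)]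
  refine lt_of_mul_lt_mul_right ?_
    (mul_nonneg hΦ.le (measureReal_nonneg (μ := sphereMeasure n) (s := univ)))
  rw [one_mul]
  exact (firstEigenvalue_mul_le_norm_gradient_testFunction_sq hn hr hrR h).trans_lt
    (norm_gradient_testFunction_sq_lt hn hr hrR h hne)

theorem firstEigenvalue_concentric (hn : 2 ≤ n) (hr : 0 < r) (hrR : r < R) (c : Euc n) :
    firstEigenvalue c R c r = (R ^ (n - 1) * radialResistance (n - 1) r R)⁻¹ := by
  have : NeZero n := ⟨by omega⟩
  have h : closedBall c r ⊆ ball c R := closedBall_subset_ball hrR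
  have hΦ := radialResistance_pos (n - 1) hr hrR
  obtain ⟨x, hx, hx0, heq⟩ := exists_firstEigenvalue_mul_norm_trace_sq_eq hn hr hrR h
  refine (firstEigenvalue_le hn hr hrR h).antisymm ?_
  rw [inv_le_iff_one_le_mul₀ (mul_pos (pow_pos (hr.trans hrR) _) hΦ)]
  refine le_of_mul_le_mul_right (a := ‖x.2.1‖ ^ 2) ?_ (by positivity)
  calc 1 * ‖x.2.1‖ ^ 2 = firstEigenvalue c R c r * ‖x.2.2‖ ^ 2 := by rw [one_mul, heq]
    _ ≤ firstEigenvalue c R c r * (R ^ (n - 1) * radialResistance (n - 1) r R * ‖x.2.1‖ ^ 2) :=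
      mul_le_mul_of_nonneg_left (norm_trace_sq_le_of_concentric hr hrR hx)
        (firstEigenvalue_pos hn hr hrR h).le
    _ = _ := (mul_assoc _ _ _).symm

end Eigenvalues

end DirichletSteklov

end

/-- For fixed radii `0 < r < R`, the first nonzero eigenvalue exists for every position of the two
balls, and it is maximal exactly when they are concentric. -/
theorem theorem1p2 (n : ℕ) (hn : 2 ≤ n) (r R : ℝ) (hr : 0 < r) (hrR : r < R) :
    (∀ c₁ c₂ : EuclideanSpace ℝ (Fin n), closedBall c₂ r ⊆ ball c₁ R →
      IsLeast (DirichletSteklov.nonzeroEigenvalues c₁ R c₂ r)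
          (DirichletSteklov.firstEigenvalue c₁ R c₂ r) ∧
        0 < DirichletSteklov.firstEigenvalue c₁ R c₂ r) ∧
    (∀ c c₁ c₂ : EuclideanSpace ℝ (Fin n), closedBall c₂ r ⊆ ball c₁ R →
      DirichletSteklov.firstEigenvalue c₁ R c₂ r ≤ DirichletSteklov.firstEigenvalue c R c r ∧
        (DirichletSteklov.firstEigenvalue c₁ R c₂ r = DirichletSteklov.firstEigenvalue c R c r ↔
          c₁ = c₂)) := by
  refine ⟨fun c₁ c₂ h => ⟨DirichletSteklov.isLeast_firstEigenvalue hn hr hrR h,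
    DirichletSteklov.firstEigenvalue_pos hn hr hrR h⟩, fun c c₁ c₂ h => ?_⟩
  rw [DirichletSteklov.firstEigenvalue_concentric hn hr hrR c]
  refine ⟨DirichletSteklov.firstEigenvalue_le hn hr hrR h, fun heq => ?_, ?_⟩
  · by_contra hne
    exact (DirichletSteklov.firstEigenvalue_lt hn hr hrR h hne).ne heq
  · rintro rfl
    exact DirichletSteklov.firstEigenvalue_concentric hn hr hrR c₁
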